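/- For a Borel probability distribution $P$ on $\mathbb{R}^d$ ($d\ge 1$) the halfspace depth of $x\in\mathbb{R}^d$ is $$D(x;P)=\inf_{\|u\|_2=1}P\big(\{y\in\mathbb{R}^d:\langle y,u\rangle\le\langle x,u\rangle\}\big),$$ and the halfspace median $\mu^{hs}=\mu^{hs}(P)$ is the barycenter (mean of the uniform distribution) of the nonempty compact convex set of all points $x$ that maximize $D(\cdot;P)$ over $\mathbb{R}^d$. The sample halfspace median $\hat\mu_n^{hs}$ of $X_1,\dots,X_n$ is the halfspace median of the empirical distribution, which puts mass $1/n$ on each $X_i$. There exist absolute constants $C_1,C_2>0$ (not depending on $d,n,\varepsilon,\delta,P,Q$) such that the following holds for every $d\ge 1$, all Borel probability distributions $P,Q$ on $\mathbb{R}^d$, every $0\le\varepsilon<1/3$, every $\delta\in(0,1/2)$, and every positive integer $n$ with $\sqrt{\log(1/\delta)/(2n)}<1/3$. If $X_1,\dots,X_n$ are independent random vectors with common distribution $(1-\varepsilon)P+\varepsilon Q$, then $$\big|D(\mu^{hs};P)-D(\hat\mu_n^{hs};P)\big|\le\frac{\varepsilon}{1-\varepsilon}+C_1\sqrt{\frac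 dn}+C_2\sqrt{\frac{\log(1/\delta)}{n}}$$ with probability at least $1-2\delta$. -/

import Mathlib

open MeasureTheory ProbabilityTheory
open scoped ENNReal

noncomputable section

namespace HalfspaceDepth

/-- Halfspace (Tukey) depth of the point `x` with respect to the measure `P` on `ℝᵈ`: the infimum
over unit vectors `u` of the mass of the closed halfspace `{y | ⟪y, u⟫ ≤ ⟪x, u⟫}`. -/
def depth {d : ℕ} (x : EuclideanSpace ℝ (Fin d)) (P : Measure (EuclideanSpace ℝ (Fin d))) : ℝ :=
  ⨅ u : Metric.sphere (0 : EuclideanSpace ℝ (Fin d)) 1,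
    P.real {y | inner ℝ y (u : EuclideanSpace ℝ (Fin d)) ≤
      inner ℝ x (u : EuclideanSpace ℝ (Fin d))}

/-- Halfspace median set: all points of maximal halfspace depth. -/
def medianSet {d : ℕ} (P : Measure (EuclideanSpace ℝ (Fin d))) :
    Set (EuclideanSpace ℝ (Fin d)) :=
  {x | ∀ y, depth y P ≤ depth x P}

/-- Barycenter of a nonempty compact convex set `S`: the mean of the uniform distribution on `S`.
As `S` may have a smaller dimension `k` than the ambient space, the uniform distribution is
the normalized restriction to `S` of the `k`-dimensional Hausdorff measure, where `k` is
the dimension of the affine hull of `S`. -/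
def barycenter {d : ℕ} (S : Set (EuclideanSpace ℝ (Fin d))) : EuclideanSpace ℝ (Fin d) :=
  ⨍ x in S, x ∂(Measure.hausdorffMeasure (Module.finrank ℝ (vectorSpan ℝ S) : ℝ))

/-- Halfspace median: the barycenter of the halfspace median set. -/
def median {d : ℕ} (P : Measure (EuclideanSpace ℝ (Fin d))) : EuclideanSpace ℝ (Fin d) :=
  barycenter (medianSet P)

/-- Empirical distribution of the points `x 0, …, x (n - 1)`: mass `1 / n` at each of them. -/
def empiricalMeasure {d n : ℕ} (x : Fin n → EuclideanSpace ℝ (Fin d)) :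
    Measure (EuclideanSpace ℝ (Fin d)) :=
  (n : ℝ≥0∞)⁻¹ • ∑ i, Measure.dirac (x i)

/-- Sample halfspace median: the halfspace median of the empirical distribution. -/
def sampleMedian {d n : ℕ} (x : Fin n → EuclideanSpace ℝ (Fin d)) : EuclideanSpace ℝ (Fin d) :=
  median (empiricalMeasure x)

/-- The contaminated distribution `(1 - ε) P + ε Q`. -/
def contaminated {d : ℕ} (ε : ℝ) (P Q : Measure (EuclideanSpace ℝ (Fin d))) :
    Measure (EuclideanSpace ℝ (Fin d)) :=
  ENNReal.ofReal (1 - ε) • P + ENNReal.ofReal ε • Q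

end HalfspaceDepth

end

/-! Two facts about halfspace masses give the theorem. If two probability measures differ by at most
`a` on every closed halfspace, their depths differ by at most `a` at every point; contamination
multiplies masses by `1 - ε` and adds at most `ε`. Comparing depths at the two medians, and using
that the sample median is deepest for the empirical measure, bounds the loss by `(ε + 2 * a) / (1 -
ε)` (`abs_depth_median_sub_le`). This requires the barycenter to be a maximizer: maximizers exist by
the centerpoint theorem and upper semicontinuity, they form a compact convex set, and such a set
contains its barycenter (`median_mem_medianSet`).

It remains to bound `a` by a multiple of `√((d + log (1/δ)) / n)`, with no factor `log n`. A ghost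
sample and random swaps reduce the deviation to signed counts over the traces of halfspaces on fixed
points (`measure_ghost_le`). By Radon's theorem halfspaces shatter at most `d + 1` points, so a
family of traces separated at relative scale `e` has at most `(4 / e) ^ (3 * (d + 1))` members,
whatever the number of points (`card_le_of_separated_traces`). Chaining through nets at the scales
`4 ^ (-k)`, with Hoeffding's inequality on each link, then gives the bound
(`card_exists_traces_lt_abs_signSum_le`). -/

namespace HalfspaceDepth

/-- The closed halfspace `{y | ⟪y, u⟫ ≤ t}` (all of space or empty when `u = 0`). -/
def halfspace {d : ℕ} (u : EuclideanSpace ℝ (Fin d)) (t : ℝ) : Set (EuclideanSpace ℝ (Fin d)) :=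
  {y | inner ℝ y u ≤ t}

lemma isLinearMap_inner_left {d : ℕ} (u : EuclideanSpace ℝ (Fin d)) :
    IsLinearMap ℝ fun y : EuclideanSpace ℝ (Fin d) => inner ℝ y u :=
  ⟨fun x y => inner_add_left x y u, fun c x => real_inner_smul_left x u c⟩

open Classical in
/-- The subsets of the index set cut out of the points `x i` by closed halfspaces. -/
noncomputable def traces {d : ℕ} {ι : Type*} [Fintype ι] (x : ι → EuclideanSpace ℝ (Fin d)) :
    Finset (Finset ι) :=
  {A | ∃ u t, ∀ i, i ∈ A ↔ x i ∈ halfspace u t}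

/-! ### Shattering, packing and nets for traces of halfspaces. -/

section Combinatorics

variable {d : ℕ} {ι κ : Type*} [Fintype ι] [Fintype κ]

lemma mem_traces {x : ι → EuclideanSpace ℝ (Fin d)} {A : Finset ι} :
    A ∈ traces x ↔ ∃ u t, ∀ i, i ∈ A ↔ x i ∈ halfspace u t := by
  simp [traces]

lemma empty_mem_traces (x : ι → EuclideanSpace ℝ (Fin d)) : ∅ ∈ traces x :=
  mem_traces.2 ⟨0, -1, fun i => by simp [halfspace]⟩

/-- More than `d + 1` points are affinely dependent, hence have a Radon partition into two parts
whose convex hulls meet. A halfspace cutting out exactly one part would contain the common point,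
while its open complement would contain it too. -/
lemma card_le_of_shatters_traces [DecidableEq ι] {x : ι → EuclideanSpace ℝ (Fin d)} {s : Finset ι}
    (hs : (traces x).Shatters s) : s.card ≤ d + 1 := by
  by_contra! hcard
  have hdep : ¬ AffineIndependent ℝ (fun i : s => x i) := by
    intro h
    have h1 := h.card_le_finrank_succ
    have h2 := Submodule.finrank_le (vectorSpan ℝ (Set.range fun i : s => x i))
    simp only [Fintype.card_coe, finrank_euclideanSpace, Fintype.card_fin] at h1 h2
    omega
  obtain ⟨I, p, hpI, hpJ⟩ := Convex.radon_partition hdep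
  classical
  obtain ⟨A, hA, hsA⟩ := hs (t := s.filter fun i => ∃ h : i ∈ s, (⟨i, h⟩ : s) ∈ I)
    (Finset.filter_subset _ _)
  obtain ⟨u, t, hut⟩ := mem_traces.1 hA
  have key (i : s) : i ∈ I ↔ inner ℝ (x i) u ≤ t := by
    have h := Finset.ext_iff.1 hsA i
    have h2 : inner ℝ (x i) u ≤ t ↔ (i : ι) ∈ A := (hut i).symm
    rw [h2]
    simpa using h.symm
  have h1 : inner ℝ p u ≤ t := by
    refine convexHull_min ?_ (convex_halfSpace_le (isLinearMap_inner_left u) t) hpI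
    rintro _ ⟨i, hi, rfl⟩
    exact (key i).1 hi
  have h2 : t < inner ℝ p u := by
    refine convexHull_min ?_ (convex_halfSpace_gt (isLinearMap_inner_left u) t) hpJ
    rintro _ ⟨i, hi, rfl⟩
    exact not_le.1 fun h => hi ((key i).2 h)
  exact absurd h1 (not_le.2 h2)

/-- A family has no more members than it shatters sets (Pajor's form of Sauer–Shelah). Weighting a
shattered `s` by `z ^ s.card ≥ z ^ v` and summing over all finsets gives a binomial expansion. The
parameter `z` stays free, to be tuned to the packing scale. -/
lemma card_mul_pow_le_of_shatters [DecidableEq ι] {T : Finset (Finset ι)} {v : ℕ}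
    (hT : ∀ s, T.Shatters s → s.card ≤ v) {z : ℝ} (hz : 0 < z) (hz1 : z ≤ 1) :
    (T.card : ℝ) * z ^ v ≤ Real.exp (z * Fintype.card ι) := by
  calc (T.card : ℝ) * z ^ v ≤ T.shatterer.card * z ^ v := by
        have := Finset.card_le_card_shatterer T
        exact mul_le_mul_of_nonneg_right (by exact_mod_cast this) (by positivity)
    _ = ∑ s ∈ T.shatterer, z ^ v := by simp
    _ ≤ ∑ s ∈ T.shatterer, z ^ s.card := by
        refine Finset.sum_le_sum fun s hs => ?_
        exact pow_le_pow_of_le_one hz.le hz1 (hT s (Finset.mem_shatterer.1 hs))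
    _ ≤ ∑ s : Finset ι, z ^ s.card :=
        Finset.sum_le_univ_sum_of_nonneg fun s => by positivity
    _ = (z + 1) ^ Fintype.card ι := by
        rw [← Fintype.sum_pow_mul_eq_add_pow ι z 1]
        simp
    _ ≤ Real.exp z ^ Fintype.card ι := by
        gcongr
        exact Real.add_one_le_exp z
    _ = Real.exp (z * Fintype.card ι) := by rw [← Real.exp_nat_mul, mul_comm]

lemma card_traces_mul_pow_le (x : ι → EuclideanSpace ℝ (Fin d)) {z : ℝ} (hz : 0 < z)
    (hz1 : z ≤ 1) :
    ((traces x).card : ℝ) * z ^ (d + 1) ≤ Real.exp (z * Fintype.card ι) := by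
  classical
  exact card_mul_pow_le_of_shatters (fun s hs => card_le_of_shatters_traces hs) hz hz1

lemma filter_mem_traces_comp [DecidableEq ι] {x : ι → EuclideanSpace ℝ (Fin d)} {A : Finset ι}
    (hA : A ∈ traces x) (s : κ → ι) : (Finset.univ.filter fun j => s j ∈ A) ∈ traces (x ∘ s) := by
  obtain ⟨u, t, hut⟩ := mem_traces.1 hA
  exact mem_traces.2 ⟨u, t, fun j => by simp [hut]⟩

/-- If the sets of `N` differ pairwise on a large part of `ι`, then some short sample of points of
`ι` tells all of them apart. -/
lemma exists_sample_separating [DecidableEq ι] {N : Finset (Finset ι)} {e : ℝ}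
    (hN : ∀ A ∈ N, ∀ B ∈ N, A ≠ B → e * Fintype.card ι ≤ (symmDiff A B).card) {m : ℕ}
    (hm : (N.card : ℝ) ^ 2 ≤ Real.exp (e * m)) (hcard : 2 ≤ N.card) :
    ∃ s : Fin m → ι, ∀ A ∈ N, ∀ B ∈ N, (∀ j, s j ∈ A ↔ s j ∈ B) → A = B := by
  by_contra! hbad
  have hn : 0 < Fintype.card ι := by
    rcases isEmpty_or_nonempty ι with h | h
    · have := Finset.card_le_univ N
      simp at this
      omega
    · exact Fintype.card_pos
  set n := Fintype.card ι with hndef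
  -- If no sample separates, each sample misses the symmetric difference of some pair. For one pair
  -- this happens for at most `n ^ m * exp (-(e * m))` samples, and there are fewer than `N.card ^
  -- 2` ordered pairs: too few to account for all `n ^ m` samples.
  have hcover : (Finset.univ : Finset (Fin m → ι)) ⊆
      N.offDiag.biUnion fun p => Fintype.piFinset fun _ => (symmDiff p.1 p.2)ᶜ := by
    intro s _
    obtain ⟨A, hA, B, hB, hs, hAB⟩ := hbad s
    simp only [Finset.mem_biUnion, Finset.mem_offDiag, Fintype.mem_piFinset, Finset.mem_compl,
      Finset.mem_symmDiff]
    refine ⟨(A, B), ⟨hA, hB, hAB⟩, fun j => ?_⟩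
    have := hs j
    tauto
  have hle := (Finset.card_le_card hcover).trans Finset.card_biUnion_le
  have hle' : (n : ℝ) ^ m ≤ ∑ p ∈ N.offDiag, ((n : ℝ) ^ m * Real.exp (-(e * m))) := by
    have h1 : (n : ℝ) ^ m = ((Finset.univ : Finset (Fin m → ι)).card : ℝ) := by
      simp [hndef]
    rw [h1]
    refine (Nat.cast_le.2 hle).trans ?_
    push_cast
    refine Finset.sum_le_sum fun p hp => ?_
    rw [Finset.mem_offDiag] at hp
    rw [← h1]
    simp only [Fintype.card_piFinset, Finset.prod_const, Finset.card_univ, Fintype.card_fin,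
      Nat.cast_pow]
    have h2 : (((symmDiff p.1 p.2)ᶜ.card : ℕ) : ℝ) ≤ n * Real.exp (-e) := by
      rw [Finset.card_compl, Nat.cast_sub (Finset.card_le_univ _)]
      have h3 := hN _ hp.1 _ hp.2.1 hp.2.2
      have h4 := Real.add_one_le_exp (-e)
      have h5 : (0 : ℝ) < n := by exact_mod_cast hn
      nlinarith
    calc (((symmDiff p.1 p.2)ᶜ.card : ℕ) : ℝ) ^ m ≤ (n * Real.exp (-e)) ^ m := by gcongr
      _ = (n : ℝ) ^ m * Real.exp (-(e * m)) := by
          rw [mul_pow, ← Real.exp_nat_mul]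
          ring_nf
  rw [Finset.sum_const, Finset.offDiag_card, nsmul_eq_mul, Nat.cast_sub (Nat.le_mul_self _)] at hle'
  push_cast at hle'
  have hnm : (0 : ℝ) < (n : ℝ) ^ m := by positivity
  have hM : (2 : ℝ) ≤ N.card := by exact_mod_cast hcard
  have hexp : (N.card : ℝ) ^ 2 * Real.exp (-(e * m)) ≤ 1 := by
    rw [Real.exp_neg, ← div_eq_mul_inv]
    exact (div_le_one (Real.exp_pos _)).2 hm
  have hE := Real.exp_pos (-(e * m))
  have h6 : ((N.card : ℝ) * N.card - N.card) * Real.exp (-(e * m)) < 1 := by nlinarith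
  nlinarith

/-- Packing bound for traces of halfspaces. -/
lemma card_le_of_separated_traces [DecidableEq ι] {x : ι → EuclideanSpace ℝ (Fin d)}
    {N : Finset (Finset ι)} (hNx : N ⊆ traces x) {e : ℝ} (he : 0 < e) (he1 : e ≤ 1)
    (hN : ∀ A ∈ N, ∀ B ∈ N, A ≠ B → e * Fintype.card ι ≤ (symmDiff A B).card) :
    (N.card : ℝ) ≤ Real.exp (3 * (d + 1) * Real.log (4 / e)) := by
  have hlog4 : 1 ≤ Real.log (4 / e) := by
    rw [Real.le_log_iff_exp_le (by positivity), le_div_iff₀ he]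
    nlinarith [Real.exp_one_lt_d9, Real.exp_pos 1]
  rcases Nat.lt_or_ge N.card 2 with hlt | hge
  · have : (N.card : ℝ) ≤ 1 := by exact_mod_cast Nat.le_of_lt_succ hlt
    exact this.trans (Real.one_le_exp (by positivity))
  have hM : (2 : ℝ) ≤ N.card := by exact_mod_cast hge
  have hM0 : (0 : ℝ) < N.card := by linarith
  have hlogM : 0 ≤ Real.log N.card := Real.log_nonneg (by linarith)
  -- The shortest sample length for which `N.card ^ 2 ≤ exp (e * m)`.
  set m := ⌈2 * Real.log N.card / e⌉₊ with hm
  have hm1 : 2 * Real.log N.card / e ≤ m := Nat.le_ceil _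
  have hm2 : (m : ℝ) < 2 * Real.log N.card / e + 1 := Nat.ceil_lt_add_one (by positivity)
  obtain ⟨s, hs⟩ := exists_sample_separating hN (m := m) (by
    rw [div_le_iff₀ he] at hm1
    rw [← Real.exp_log hM0, ← Real.exp_nat_mul, Real.exp_le_exp]
    push_cast
    linarith) hge
  have hinj : N.card ≤ (traces (x ∘ s)).card := by
    refine Finset.card_le_card_of_injOn (fun A => Finset.univ.filter fun j => s j ∈ A)
      (fun A hA => filter_mem_traces_comp (hNx hA) s) ?_
    intro A hA B hB hAB
    refine hs A hA B hB fun j => ?_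
    simpa using Finset.ext_iff.1 hAB j
  -- With `z = e / 4` the exponent `z * m` is at most `log N.card / 2 + 1 / 4`, so half of `log
  -- N.card` survives on the left.
  have hsauer := card_traces_mul_pow_le (x ∘ s) (z := e / 4) (by positivity) (by linarith)
  have h1 : (N.card : ℝ) * (e / 4) ^ (d + 1) ≤ Real.exp (e / 4 * m) := by
    refine le_trans ?_ (hsauer.trans (by simp))
    gcongr
  have h2 := Real.log_le_log (by positivity) h1
  rw [Real.log_exp, Real.log_mul hM0.ne' (by positivity), Real.log_pow] at h2
  have h3 : Real.log (e / 4) = - Real.log (4 / e) := by rw [← Real.log_inv, inv_div]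
  rw [h3] at h2
  push_cast at h2
  have h4 : e / 4 * m ≤ Real.log N.card / 2 + 1 / 4 := by
    have : e / 4 * m ≤ e / 4 * (2 * Real.log N.card / e + 1) := by gcongr
    have h5 : e / 4 * (2 * Real.log N.card / e + 1) = Real.log N.card / 2 + e / 4 := by
      field_simp
      ring
    linarith
  rw [← Real.log_le_iff_le_exp hM0]
  have h6 : (1 : ℝ) ≤ (d + 1) * Real.log (4 / e) := by
    have : (0 : ℝ) ≤ d := by positivity
    nlinarith
  nlinarith

/-- A separated family of maximal cardinality is a net: a trace far from all its members could be
added to it. -/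
lemma exists_net_traces [DecidableEq ι] (x : ι → EuclideanSpace ℝ (Fin d)) {e : ℝ} (he : 0 < e)
    (he1 : e ≤ 1) :
    ∃ N ⊆ traces x, (N.card : ℝ) ≤ Real.exp (3 * (d + 1) * Real.log (4 / e)) ∧
      ∀ A ∈ traces x, ∃ B ∈ N, ((symmDiff A B).card : ℝ) ≤ e * Fintype.card ι := by
  classical
  let F : Finset (Finset (Finset ι)) := (traces x).powerset.filter fun N =>
    ∀ A ∈ N, ∀ B ∈ N, A ≠ B → e * Fintype.card ι ≤ (symmDiff A B).card
  obtain ⟨N, hN, hmax⟩ := F.exists_max_image Finset.card ⟨∅, by simp [F]⟩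
  simp only [F, Finset.mem_filter, Finset.mem_powerset] at hN hmax
  refine ⟨N, hN.1, card_le_of_separated_traces hN.1 he he1 hN.2, fun A hA => ?_⟩
  by_contra! hfar
  have hAN : A ∉ N := by
    intro h
    have := hfar A h
    simp only [symmDiff_self, Finset.bot_eq_empty, Finset.card_empty, Nat.cast_zero] at this
    have : 0 ≤ e * Fintype.card ι := by positivity
    linarith
  have hcard := hmax (insert A N) ⟨Finset.insert_subset hA hN.1, ?_⟩
  · rw [Finset.card_insert_of_notMem hAN] at hcard
    omega
  · intro B hB C hC hBC
    rw [Finset.mem_insert] at hB hC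
    rcases hB with rfl | hB <;> rcases hC with rfl | hC
    · exact absurd rfl hBC
    · exact (hfar C hC).le
    · rw [symmDiff_comm]
      exact (hfar B hB).le
    · exact hN.2 B hB C hC hBC

end Combinatorics

end HalfspaceDepth

namespace HalfspaceDepth

/-! ### Rademacher sums and chaining. -/

section Signs

variable {d : ℕ} {ι : Type*} [Fintype ι]

/-- The signed sum `∑ ± a i`, the signs being given by `σ`. -/
noncomputable def signSum (σ : ι → Bool) (a : ι → ℝ) : ℝ :=
  ∑ i, (if σ i then 1 else -1) * a i

lemma signSum_sub (σ : ι → Bool) (a b : ι → ℝ) :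
    signSum σ (fun i => a i - b i) = signSum σ a - signSum σ b := by
  simp [signSum, mul_sub, Finset.sum_sub_distrib]

lemma signSum_neg (σ : ι → Bool) (a : ι → ℝ) :
    signSum σ (fun i => -a i) = -signSum σ a := by
  simp [signSum]

/-- The exponential moment factorizes over the independent signs, and `cosh y ≤ exp (y ^ 2 / 2)`
bounds each factor. -/
lemma sum_exp_signSum_le [DecidableEq ι] (a : ι → ℝ) (l : ℝ) :
    ∑ σ : ι → Bool, Real.exp (l * signSum σ a) ≤
      2 ^ Fintype.card ι * Real.exp (l ^ 2 * (∑ i, a i ^ 2) / 2) := by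
  calc ∑ σ : ι → Bool, Real.exp (l * signSum σ a)
      = ∑ σ : ι → Bool, ∏ i, Real.exp (l * ((if σ i then 1 else -1) * a i)) := by
        simp_rw [signSum, Finset.mul_sum, Real.exp_sum]
    _ = ∏ i, ∑ b : Bool, Real.exp (l * ((if b then 1 else -1) * a i)) := by
        rw [Finset.prod_univ_sum, Fintype.piFinset_univ]
    _ ≤ ∏ i, (2 * Real.exp ((l * a i) ^ 2 / 2)) := by
        refine Finset.prod_le_prod (fun i _ => Finset.sum_nonneg fun b _ => (Real.exp_pos _).le)
          fun i _ => ?_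
        have h := Real.cosh_le_exp_half_sq (l * a i)
        rw [Real.cosh_eq] at h
        simp only [Fintype.sum_bool, if_true, Bool.false_eq_true, if_false, one_mul, neg_mul,
          mul_neg]
        linarith
    _ = 2 ^ Fintype.card ι * Real.exp (l ^ 2 * (∑ i, a i ^ 2) / 2) := by
        rw [Finset.prod_mul_distrib, ← Real.exp_sum]
        simp [mul_pow, Finset.mul_sum, Finset.sum_div]

lemma card_lt_signSum_le [DecidableEq ι] (a : ι → ℝ) {t V : ℝ} (ht : 0 ≤ t) (hV : 0 < V)
    (ha : ∑ i, a i ^ 2 ≤ V) :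
    ((Finset.univ.filter fun σ : ι → Bool => t < signSum σ a).card : ℝ) ≤
      2 ^ Fintype.card ι * Real.exp (-(t ^ 2 / (2 * V))) := by
  have h1 : ((Finset.univ.filter fun σ : ι → Bool => t < signSum σ a).card : ℝ) *
      Real.exp (t / V * t) ≤ ∑ σ : ι → Bool, Real.exp (t / V * signSum σ a) := by
    rw [← nsmul_eq_mul, ← Finset.sum_const]
    refine (Finset.sum_le_sum fun σ hσ => ?_).trans
      (Finset.sum_le_univ_sum_of_nonneg fun σ => (Real.exp_pos _).le)
    have := (Finset.mem_filter.1 hσ).2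
    gcongr
  have h2 := h1.trans (sum_exp_signSum_le a (t / V))
  rw [← le_div_iff₀ (Real.exp_pos _), mul_div_assoc, ← Real.exp_sub] at h2
  refine h2.trans ?_
  have h3 : (t / V) ^ 2 * (∑ i, a i ^ 2) / 2 - t / V * t ≤ -(t ^ 2 / (2 * V)) := by
    have : (t / V) ^ 2 * (∑ i, a i ^ 2) ≤ (t / V) ^ 2 * V := by gcongr
    have h4 : (t / V) ^ 2 * V / 2 - t / V * t = -(t ^ 2 / (2 * V)) := by
      field_simp
      ring
    linarith
  gcongr

/-- **Hoeffding's inequality** for Rademacher sums, in counting form. -/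
lemma card_lt_abs_signSum_le [DecidableEq ι] (a : ι → ℝ) {t V : ℝ} (ht : 0 ≤ t)
    (hV : 0 < V)
    (ha : ∑ i, a i ^ 2 ≤ V) :
    ((Finset.univ.filter fun σ : ι → Bool => t < |signSum σ a|).card : ℝ) ≤
      2 ^ Fintype.card ι * (2 * Real.exp (-(t ^ 2 / (2 * V)))) := by
  have h1 := card_lt_signSum_le a ht hV ha
  have h2 := card_lt_signSum_le (fun i => -a i) ht hV (by simpa using ha)
  have h3 : (Finset.univ.filter fun σ : ι → Bool => t < |signSum σ a|).card ≤
      (Finset.univ.filter fun σ : ι → Bool => t < signSum σ a).card +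
      (Finset.univ.filter fun σ : ι → Bool => t < signSum σ fun i => -a i).card := by
    refine (Finset.card_le_card ?_).trans (Finset.card_union_le _ _)
    intro σ hσ
    simpa [signSum_neg, lt_abs] using hσ
  have h4 : ((Finset.univ.filter fun σ : ι → Bool => t < |signSum σ a|).card : ℝ) ≤ _ :=
    Nat.cast_le.2 h3
  push_cast at h4
  linarith

/-- The indicator of a finset of indices. -/
noncomputable def finsetInd [DecidableEq ι] (A : Finset ι) (i : ι) : ℝ := if i ∈ A then 1 else 0

/-- Turns the net distance into the variance proxy that Hoeffding's inequality needs for a link. -/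
lemma sum_sq_finsetInd_sub [DecidableEq ι] (A B : Finset ι) :
    ∑ i, (finsetInd A i - finsetInd B i) ^ 2 = (symmDiff A B).card := by
  have : ∀ i, (finsetInd A i - finsetInd B i) ^ 2 = if i ∈ symmDiff A B then 1 else 0 := by
    intro i
    by_cases hA : i ∈ A <;> by_cases hB : i ∈ B <;> simp [finsetInd, Finset.mem_symmDiff, hA, hB]
  simp [this]

lemma sum_range_two_inv_pow_mul_le (K : ℕ) :
    ∑ k ∈ Finset.range K, ((1 / 2 : ℝ) ^ k * (k + 2)) ≤ 6 := by
  have : ∑ k ∈ Finset.range K, ((1 / 2 : ℝ) ^ k * (k + 2)) = 6 - (1 / 2 : ℝ) ^ K * (2 * K + 6) := by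
    induction K with
    | zero => norm_num
    | succ K ih =>
      rw [Finset.sum_range_succ, ih, pow_succ]
      push_cast
      ring
  rw [this]
  have : (0 : ℝ) ≤ (1 / 2 : ℝ) ^ K * (2 * K + 6) := by positivity
  linarith

/-- The radii `4 ^ (-k)` for symmetric differences are radii `2 ^ (-k)` in `L²`. At level `0` the
radius is the whole index set, so `∅` alone suffices and every chain starts from a zero sum. -/
lemma exists_nets [DecidableEq ι] (x : ι → EuclideanSpace ℝ (Fin d)) :
    ∃ N : ℕ → Finset (Finset ι), N 0 = {∅} ∧ (∀ k, N k ⊆ traces x) ∧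
      (∀ k, ((N (k + 1)).card : ℝ) ≤ Real.exp (3 * (d + 1) * ((k + 2) * Real.log 4))) ∧
      ∀ k, ∀ A ∈ traces x, ∃ B ∈ N k,
        ((symmDiff A B).card : ℝ) ≤ (1 / 4) ^ k * Fintype.card ι := by
  have h (k : ℕ) := exists_net_traces x (e := (1 / 4 : ℝ) ^ k) (by positivity)
    (pow_le_one₀ (by norm_num) (by norm_num))
  choose M hsub hcard hnet using h
  refine ⟨fun k => if k = 0 then {∅} else M k, by simp, fun k => ?_, fun k => ?_, fun k A hA => ?_⟩
  · by_cases hk : k = 0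
    · simpa [hk] using empty_mem_traces x
    · simpa [hk] using hsub k
  · have h1 : (4 : ℝ) / (1 / 4) ^ (k + 1) = 4 ^ (k + 2) := by
      rw [one_div, inv_pow, div_inv_eq_mul]
      ring
    have h2 := hcard (k + 1)
    rw [h1, Real.log_pow] at h2
    simpa using h2
  · by_cases hk : k = 0
    · refine ⟨∅, by simp [hk], ?_⟩
      rw [← Finset.bot_eq_empty, symmDiff_bot]
      simpa [hk] using Finset.card_le_univ A
    · simpa [hk] using hnet k A hA

/-- Chaining bound: for all but a fraction `exp (-L)` of the signs, all signed counts over traces of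
halfspaces are `O(√(n (d + 1 + L)))`. -/
lemma card_exists_traces_lt_abs_signSum_le [DecidableEq ι] (x : ι → EuclideanSpace ℝ (Fin d))
    {L : ℝ} (hL : 0 ≤ L) (hn : 0 < Fintype.card ι) :
    ((Finset.univ.filter fun σ : ι → Bool => ∃ A ∈ traces x,
      6 * Real.sqrt (2 * Fintype.card ι * (5 * (d + 1) + L)) <
        |signSum σ (finsetInd A)|).card : ℝ) ≤
      2 ^ Fintype.card ι * Real.exp (-L) := by
  obtain ⟨N, hN0, hNx, hNcard, hNnet⟩ := exists_nets x
  choose! p hpN hpd using hNnet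
  set n := Fintype.card ι with hndef
  have hn' : (0 : ℝ) < n := by exact_mod_cast hn
  set W : ℝ := 5 * (d + 1) + L with hW
  have hW0 : 0 < W := by positivity
  set r : ℝ := Real.sqrt (2 * n * W) with hr
  have hr2 : r ^ 2 = 2 * n * W := Real.sq_sqrt (by positivity)
  -- At level `K` the radius is below one point, so the net contains every trace and the chain can
  -- stop.
  obtain ⟨K, hK⟩ : ∃ K : ℕ, (1 / 4 : ℝ) ^ K * n < 1 := by
    obtain ⟨K, hK⟩ := exists_pow_lt_of_lt_one (y := (1 / 4 : ℝ)) (x := 1 / (n : ℝ)) (by positivity)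
      (by norm_num)
    exact ⟨K, (lt_div_iff₀ hn').1 hK⟩
  -- The factor `(1 / 2) ^ k` is the `L²` size of a link. The factor `k + 2` makes the Hoeffding
  -- exponent `(k + 2) ^ 2 * W`, enough to beat the net entropy, which is linear in `k`; the
  -- thresholds still sum to at most `6 * r`.
  let t : ℕ → ℝ := fun k => (1 / 2) ^ k * (k + 2) * r
  let bad : ℕ → Finset ι → Finset (ι → Bool) := fun k A => Finset.univ.filter fun σ =>
    t k < |signSum σ (fun i => finsetInd A i - finsetInd (p k A) i)|
  have hlink (k : ℕ) (A : Finset ι) (hA : A ∈ N (k + 1)) :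
      ((bad k A).card : ℝ) ≤ 2 ^ n * (2 * Real.exp (-((k + 2) * W))) := by
    have hV : (0 : ℝ) < (1 / 4) ^ k * n := by positivity
    refine (card_lt_abs_signSum_le _ (t := t k) (V := (1 / 4) ^ k * n) (by positivity) hV ?_).trans
      ?_
    · rw [sum_sq_finsetInd_sub]
      exact hpd k A (hNx _ hA)
    · have h1 : t k ^ 2 / (2 * ((1 / 4) ^ k * n)) = (k + 2) ^ 2 * W := by
        have : ((1 / 2 : ℝ) ^ k) ^ 2 = (1 / 4) ^ k := by
          rw [← pow_mul, mul_comm, pow_mul]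
          norm_num
        simp only [t, mul_pow, hr2, this]
        field_simp
      rw [h1]
      have h2 : ((k : ℝ) + 2) * W ≤ (k + 2) ^ 2 * W := by
        have : (0 : ℝ) ≤ k := by positivity
        gcongr
        nlinarith
      gcongr
  have hlevel (k : ℕ) : ∑ A ∈ N (k + 1), ((bad k A).card : ℝ) ≤
      2 ^ n * Real.exp (-L) * (1 / 2) ^ (k + 1) := by
    refine (Finset.sum_le_sum (hlink k)).trans ?_
    rw [Finset.sum_const, nsmul_eq_mul]
    have h1 : ((N (k + 1)).card : ℝ) * (2 * Real.exp (-((k + 2) * W))) ≤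
        Real.exp (-L) * (1 / 2) ^ (k + 1) := by
      have h2 : (1 / 2 : ℝ) ^ (k + 1) = Real.exp (-((k + 1) * Real.log 2)) := by
        rw [Real.exp_neg, show ((k : ℝ) + 1) = ((k + 1 : ℕ) : ℝ) by push_cast; rfl,
          Real.exp_nat_mul, Real.exp_log (by norm_num)]
        simp
      have h3 : (2 : ℝ) = Real.exp (Real.log 2) := (Real.exp_log (by norm_num)).symm
      calc ((N (k + 1)).card : ℝ) * (2 * Real.exp (-((k + 2) * W)))
          ≤ Real.exp (3 * (d + 1) * ((k + 2) * Real.log 4)) *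
            (Real.exp (Real.log 2) * Real.exp (-((k + 2) * W))) := by
              rw [← h3]
              gcongr
              exact hNcard k
        _ ≤ Real.exp (-L) * (1 / 2) ^ (k + 1) := by
              rw [h2, ← Real.exp_add, ← Real.exp_add, ← Real.exp_add, Real.exp_le_exp]
              have h4 : Real.log 4 = 2 * Real.log 2 := by
                rw [show (4 : ℝ) = 2 ^ 2 by norm_num, Real.log_pow]
                norm_num
              have h5 : Real.log 2 < 0.7 := Real.log_two_lt_d9.trans (by norm_num)
              have h6 : 0 < Real.log 2 := Real.log_pos (by norm_num)
              have hk : (0 : ℝ) ≤ k := by positivity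
              have hd : (0 : ℝ) ≤ d := by positivity
              -- The origin of the `5` in `W`: the left side is at most `7 * (d + 1) * log 2`, and
              -- `7 * log 2 < 5`.
              have h7 : 3 * ((d : ℝ) + 1) * Real.log 4 + Real.log 2 ≤ 5 * (d + 1) := by
                rw [h4]
                nlinarith
              have h8 : (k + 2) * (3 * ((d : ℝ) + 1) * Real.log 4 + Real.log 2) ≤
                  (k + 2) * (5 * (d + 1)) := by gcongr
              have h9 : L ≤ (k + 2) * L := by nlinarith
              rw [hW]
              linarith
    calc ((N (k + 1)).card : ℝ) * (2 ^ n * (2 * Real.exp (-((k + 2) * W))))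
        = 2 ^ n * (((N (k + 1)).card : ℝ) * (2 * Real.exp (-((k + 2) * W)))) := by ring
      _ ≤ 2 ^ n * (Real.exp (-L) * (1 / 2) ^ (k + 1)) := by gcongr
      _ = _ := by ring
  have hcover : (Finset.univ.filter fun σ : ι → Bool => ∃ A ∈ traces x,
      6 * r < |signSum σ (finsetInd A)|) ⊆
      (Finset.range K).biUnion fun k => (N (k + 1)).biUnion fun A => bad k A := by
    intro σ hσ
    obtain ⟨A, hA, hlt⟩ := (Finset.mem_filter.1 hσ).2
    by_contra hgood
    have hstep : ∀ k < K, ∀ A ∈ N (k + 1),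
        |signSum σ (finsetInd A) - signSum σ (finsetInd (p k A))| ≤ t k := by
      intro k hk A hA
      by_contra! h
      rw [← signSum_sub] at h
      refine hgood (Finset.mem_biUnion.2 ⟨k, Finset.mem_range.2 hk, Finset.mem_biUnion.2
        ⟨A, hA, Finset.mem_filter.2 ⟨Finset.mem_univ _, h⟩⟩⟩)
    have hsum : ∀ k ≤ K, ∀ A ∈ N k,
        |signSum σ (finsetInd A)| ≤ ∑ j ∈ Finset.range k, t j := by
      intro k
      induction k with
      | zero =>
        intro _ A hA
        rw [hN0, Finset.mem_singleton] at hA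
        simp [hA, signSum, finsetInd]
      | succ k ih =>
        intro hk A hA
        rw [Finset.sum_range_succ]
        have h1 := hstep k (by omega) A hA
        have h2 := ih (by omega) (p k A) (hpN k A (hNx _ hA))
        have h3 := abs_sub_abs_le_abs_sub (signSum σ (finsetInd A)) (signSum σ (finsetInd (p k A)))
        linarith
    have hAK : A ∈ N K := by
      have h1 := hpd K A hA
      have h2 : (symmDiff A (p K A)).card = 0 := by
        have : ((symmDiff A (p K A)).card : ℝ) < 1 := h1.trans_lt hK
        exact Nat.lt_one_iff.1 (by exact_mod_cast this)
      rw [Finset.card_eq_zero, ← Finset.bot_eq_empty, symmDiff_eq_bot] at h2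
      rw [h2]
      exact hpN K A hA
    have h4 := hsum K le_rfl A hAK
    have h5 : ∑ j ∈ Finset.range K, t j ≤ 6 * r := by
      simp only [t]
      rw [← Finset.sum_mul]
      exact mul_le_mul_of_nonneg_right (sum_range_two_inv_pow_mul_le K) (Real.sqrt_nonneg _)
    linarith
  have h1 := (Finset.card_le_card hcover).trans (Finset.card_biUnion_le.trans
    (Finset.sum_le_sum fun k _ => Finset.card_biUnion_le))
  have h2 : ((Finset.univ.filter fun σ : ι → Bool => ∃ A ∈ traces x,
      6 * r < |signSum σ (finsetInd A)|).card : ℝ) ≤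
      ∑ k ∈ Finset.range K, ∑ A ∈ N (k + 1), ((bad k A).card : ℝ) := by exact_mod_cast h1
  refine h2.trans ((Finset.sum_le_sum fun k _ => hlevel k).trans ?_)
  rw [← Finset.mul_sum]
  have h3 : ∑ k ∈ Finset.range K, (1 / 2 : ℝ) ^ (k + 1) ≤ 1 := by
    have : ∑ k ∈ Finset.range K, (1 / 2 : ℝ) ^ (k + 1) = 1 - (1 / 2) ^ K := by
      clear h2 h1 hcover hK
      induction K with
      | zero => simp
      | succ K ih =>
        rw [Finset.sum_range_succ, ih]
        ring
    rw [this]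
    have : (0 : ℝ) ≤ (1 / 2) ^ K := by positivity
    linarith
  exact mul_le_of_le_one_right (by positivity) h3

end Signs

end HalfspaceDepth

namespace HalfspaceDepth

/-! ### From signed counts to uniform deviations of halfspace frequencies. -/

section Symmetrization

variable {d n : ℕ}

lemma measurableSet_halfspace (u : EuclideanSpace ℝ (Fin d)) (t : ℝ) :
    MeasurableSet (halfspace u t) :=
  (isClosed_le (by fun_prop) continuous_const).measurableSet

/-- The number of the points `x i` that lie in `H`. -/
noncomputable def count (x : Fin n → EuclideanSpace ℝ (Fin d))
    (H : Set (EuclideanSpace ℝ (Fin d))) : ℝ :=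
  ∑ i, H.indicator 1 (x i)

lemma measurable_count {H : Set (EuclideanSpace ℝ (Fin d))} (hH : MeasurableSet H) :
    Measurable fun x : Fin n → EuclideanSpace ℝ (Fin d) => count x H :=
  Finset.measurable_sum _ fun i _ =>
    (measurable_one.indicator hH).comp (measurable_pi_apply i)

/-- Chebyshev's inequality: each indicator has variance at most `1 / 4`. -/
lemma measure_le_abs_count_sub_le (R : Measure (EuclideanSpace ℝ (Fin d)))
    [IsProbabilityMeasure R] {H : Set (EuclideanSpace ℝ (Fin d))} (hH : MeasurableSet H) {r : ℝ}
    (hr : 0 < r) (hnr : n ≤ 2 * r ^ 2) :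
    (Measure.pi fun _ : Fin n => R) {x | r ≤ |count x H - n * R.real H|} ≤ 1 / 2 := by
  let f : EuclideanSpace ℝ (Fin d) → ℝ := H.indicator 1
  have hfm : Measurable f := measurable_one.indicator hH
  have hf01 (y) : f y ∈ Set.Icc (0 : ℝ) 1 := by
    by_cases hy : y ∈ H <;> simp [f, hy]
  have hfL : MemLp f 2 R := by
    refine MemLp.of_bound hfm.aestronglyMeasurable 1 (Filter.Eventually.of_forall fun y => ?_)
    rw [Real.norm_eq_abs, abs_of_nonneg (hf01 y).1]
    exact (hf01 y).2
  have hcount : (fun x : Fin n → EuclideanSpace ℝ (Fin d) => count x H) =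
      ∑ i : Fin n, fun x => f (x i) := by
    ext x
    simp [count, f]
  have hL : MemLp (fun x : Fin n → EuclideanSpace ℝ (Fin d) => count x H) 2
      (Measure.pi fun _ : Fin n => R) := by
    rw [hcount]
    exact memLp_finsetSum' _ fun i _ => hfL.comp_measurePreserving (measurePreserving_eval _ i)
  have hmean : ∫ x, count x H ∂(Measure.pi fun _ : Fin n => R) = n * R.real H := by
    have h1 (i : Fin n) : ∫ x, f (x i) ∂(Measure.pi fun _ : Fin n => R) = R.real H := by
      rw [integral_comp_eval (μ := fun _ : Fin n => R) hfm.aestronglyMeasurable]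
      exact integral_indicator_one hH
    calc ∫ x, count x H ∂(Measure.pi fun _ : Fin n => R)
        = ∫ x, ∑ i, f (x i) ∂(Measure.pi fun _ : Fin n => R) := rfl
      _ = ∑ i, ∫ x, f (x i) ∂(Measure.pi fun _ : Fin n => R) := by
          refine integral_finsetSum _ fun i _ => ?_
          exact (hfL.comp_measurePreserving (measurePreserving_eval (fun _ : Fin n => R)
            i)).integrable (by norm_num)
      _ = n * R.real H := by simp [h1]
  have hvar : variance (fun x : Fin n → EuclideanSpace ℝ (Fin d) => count x H)
      (Measure.pi fun _ : Fin n => R) ≤ n / 4 := by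
    rw [hcount, variance_sum_pi (X := fun _ => f) (μ := fun _ => R) fun _ => hfL]
    refine (Finset.sum_le_sum fun i _ => variance_le_sq_of_bounded
      (Filter.Eventually.of_forall hf01) hfm.aemeasurable).trans (le_of_eq ?_)
    simp
    ring
  have h := meas_ge_le_variance_div_sq hL hr
  rw [hmean] at h
  refine h.trans ?_
  rw [show (1 / 2 : ℝ≥0∞) = ENNReal.ofReal (1 / 2) by
    rw [ENNReal.ofReal_div_of_pos (by norm_num)]; simp]
  refine ENNReal.ofReal_le_ofReal ?_
  rw [div_le_iff₀ (by positivity)]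
  linarith

/-- The deviation scale of halfspace counts given by chaining. -/
noncomputable def chainScale (d n : ℕ) (L : ℝ) : ℝ :=
  6 * Real.sqrt (2 * n * (5 * (d + 1) + L))

lemma card_exists_halfspace_lt_abs_signSum_le (x x' : Fin n → EuclideanSpace ℝ (Fin d))
    {L : ℝ} (hL : 0 ≤ L) (hn : 0 < n) (F : Set (EuclideanSpace ℝ (Fin d) × ℝ))
    [DecidablePred fun σ : Fin n → Bool => ∃ q ∈ F, 2 * chainScale d n L <
      |signSum σ fun i => (halfspace q.1 q.2).indicator 1 (x i) -
        (halfspace q.1 q.2).indicator 1 (x' i)|] :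
    ((Finset.univ.filter fun σ : Fin n → Bool => ∃ q ∈ F, 2 * chainScale d n L <
      |signSum σ fun i => (halfspace q.1 q.2).indicator 1 (x i) -
        (halfspace q.1 q.2).indicator 1 (x' i)|).card : ℝ) ≤ 2 ^ n * (2 * Real.exp (-L)) := by
  classical
  have h (y : Fin n → EuclideanSpace ℝ (Fin d)) :=
    card_exists_traces_lt_abs_signSum_le y hL (by simpa using hn)
  simp only [Fintype.card_fin] at h
  have hind (y : Fin n → EuclideanSpace ℝ (Fin d)) (q : EuclideanSpace ℝ (Fin d) × ℝ) :
      ∃ A ∈ traces y, ∀ i, finsetInd A i = (halfspace q.1 q.2).indicator 1 (y i) := by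
    refine ⟨Finset.univ.filter fun i => y i ∈ halfspace q.1 q.2,
      mem_traces.2 ⟨q.1, q.2, fun i => by simp⟩, fun i => ?_⟩
    simp [finsetInd, Set.indicator_apply]
  have hsub : (Finset.univ.filter fun σ : Fin n → Bool => ∃ q ∈ F, 2 * chainScale d n L <
      |signSum σ fun i => (halfspace q.1 q.2).indicator 1 (x i) -
        (halfspace q.1 q.2).indicator 1 (x' i)|) ⊆
      (Finset.univ.filter fun σ : Fin n → Bool => ∃ A ∈ traces x,
        chainScale d n L < |signSum σ (finsetInd A)|) ∪
      (Finset.univ.filter fun σ : Fin n → Bool => ∃ A ∈ traces x',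
        chainScale d n L < |signSum σ (finsetInd A)|) := by
    intro σ hσ
    obtain ⟨q, -, hq⟩ := (Finset.mem_filter.1 hσ).2
    obtain ⟨A, hA, hA'⟩ := hind x q
    obtain ⟨B, hB, hB'⟩ := hind x' q
    simp_rw [← hA', ← hB'] at hq
    rw [signSum_sub] at hq
    by_contra hnot
    simp only [Finset.mem_union, Finset.mem_filter, Finset.mem_univ, true_and, not_or, not_exists,
      not_and, not_lt] at hnot
    have h1 := hnot.1 A hA
    have h2 := hnot.2 B hB
    have h3 := abs_sub (signSum σ (finsetInd A)) (signSum σ (finsetInd B))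
    linarith
  have h1 : ((Finset.univ.filter fun σ : Fin n → Bool => ∃ q ∈ F, 2 * chainScale d n L <
      |signSum σ fun i => (halfspace q.1 q.2).indicator 1 (x i) -
        (halfspace q.1 q.2).indicator 1 (x' i)|).card : ℝ) ≤ _ :=
    Nat.cast_le.2 ((Finset.card_le_card hsub).trans (Finset.card_union_le _ _))
  push_cast at h1
  have h2 := h x
  have h3 := h x'
  unfold chainScale at h1 ⊢
  linarith

/-- Exchange the two entries of each pair `z i` with `σ i = false`. -/
def swapSigns {α : Type*} (σ : Fin n → Bool) (z : Fin n → α × α) (i : Fin n) : α × α :=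
  if σ i then z i else (z i).swap

lemma measurePreserving_swapSigns {α : Type*} [MeasurableSpace α] (R : Measure α)
    [IsProbabilityMeasure R] (σ : Fin n → Bool) :
    MeasurePreserving (swapSigns σ) (Measure.pi fun _ : Fin n => R.prod R)
      (Measure.pi fun _ : Fin n => R.prod R) := by
  refine measurePreserving_pi (fun _ : Fin n => R.prod R) (fun _ : Fin n => R.prod R)
    (f := fun i z => if σ i then z else z.swap) fun i => ?_
  by_cases h : σ i
  · simp only [h, if_true]
    exact MeasurePreserving.id _
  · simpa [h] using Measure.measurePreserving_swap

lemma measurableSet_ghost (F : Finset (EuclideanSpace ℝ (Fin d) × ℝ)) (a : ℝ) :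
    MeasurableSet {p : (Fin n → EuclideanSpace ℝ (Fin d)) × (Fin n → EuclideanSpace ℝ (Fin d)) |
      ∃ q ∈ F, a < |count p.1 (halfspace q.1 q.2) - count p.2 (halfspace q.1 q.2)|} := by
  have : {p : (Fin n → EuclideanSpace ℝ (Fin d)) × (Fin n → EuclideanSpace ℝ (Fin d)) |
      ∃ q ∈ F, a < |count p.1 (halfspace q.1 q.2) - count p.2 (halfspace q.1 q.2)|} =
      ⋃ q ∈ F, {p | a < |count p.1 (halfspace q.1 q.2) - count p.2 (halfspace q.1 q.2)|} := by
    ext p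
    simp
  rw [this]
  refine Finset.measurableSet_biUnion _ fun q _ => measurableSet_lt measurable_const ?_
  have h := measurable_count (n := n) (measurableSet_halfspace q.1 q.2)
  exact ((h.comp measurable_fst).sub (h.comp measurable_snd)).abs

/-- Swapping the entries of any pairs preserves the joint law, so the probability equals its average
over all `2 ^ n` sign patterns. For fixed pairs that average is a proportion of signs, bounded by
chaining in each of the two samples. -/
lemma measure_ghost_le (R : Measure (EuclideanSpace ℝ (Fin d))) [IsProbabilityMeasure R]
    {L : ℝ} (hL : 0 ≤ L) (hn : 0 < n) (F : Finset (EuclideanSpace ℝ (Fin d) × ℝ)) :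
    ((Measure.pi fun _ : Fin n => R).prod (Measure.pi fun _ : Fin n => R))
      {p | ∃ q ∈ F, 2 * chainScale d n L <
        |count p.1 (halfspace q.1 q.2) - count p.2 (halfspace q.1 q.2)|} ≤
      ENNReal.ofReal (2 * Real.exp (-L)) := by
  classical
  set G : Set ((Fin n → EuclideanSpace ℝ (Fin d)) × (Fin n → EuclideanSpace ℝ (Fin d))) :=
    {p | ∃ q ∈ F, 2 * chainScale d n L <
        |count p.1 (halfspace q.1 q.2) - count p.2 (halfspace q.1 q.2)|} with hG
  have hGm : MeasurableSet G := measurableSet_ghost F _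
  have hpres := measurePreserving_arrowProdEquivProdArrow (EuclideanSpace ℝ (Fin d))
    (EuclideanSpace ℝ (Fin d)) (Fin n) (fun _ => R) (fun _ => R)
  set e := MeasurableEquiv.arrowProdEquivProdArrow (EuclideanSpace ℝ (Fin d))
    (EuclideanSpace ℝ (Fin d)) (Fin n)
  set M : Measure (Fin n → EuclideanSpace ℝ (Fin d) × EuclideanSpace ℝ (Fin d)) :=
    Measure.pi fun _ => R.prod R with hM
  rw [← hpres.measure_preimage hGm.nullMeasurableSet]
  have hG'm : MeasurableSet (e ⁻¹' G) := e.measurable hGm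
  have hswap (σ : Fin n → Bool) : M (swapSigns σ ⁻¹' (e ⁻¹' G)) = M (e ⁻¹' G) :=
    (measurePreserving_swapSigns R σ).measure_preimage hG'm.nullMeasurableSet
  have hpoint (z : Fin n → EuclideanSpace ℝ (Fin d) × EuclideanSpace ℝ (Fin d)) :
      ∑ σ : Fin n → Bool, (swapSigns σ ⁻¹' (e ⁻¹' G)).indicator (fun _ => (1 : ℝ≥0∞)) z ≤
        ENNReal.ofReal (2 ^ n * (2 * Real.exp (-L))) := by
    have hmem (σ : Fin n → Bool) : z ∈ swapSigns σ ⁻¹' (e ⁻¹' G) ↔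
        ∃ q ∈ (F : Set (EuclideanSpace ℝ (Fin d) × ℝ)), 2 * chainScale d n L <
          |signSum σ fun i => (halfspace q.1 q.2).indicator 1 (z i).1 -
            (halfspace q.1 q.2).indicator 1 (z i).2| := by
      have hsum (q : EuclideanSpace ℝ (Fin d) × ℝ) :
          count (e (swapSigns σ z)).1 (halfspace q.1 q.2) -
            count (e (swapSigns σ z)).2 (halfspace q.1 q.2) =
          signSum σ fun i => (halfspace q.1 q.2).indicator 1 (z i).1 -
            (halfspace q.1 q.2).indicator 1 (z i).2 := by
        rw [count, count, signSum, ← Finset.sum_sub_distrib]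
        refine Finset.sum_congr rfl fun i _ => ?_
        have h1 : (e (swapSigns σ z)).1 i = (swapSigns σ z i).1 := rfl
        have h2 : (e (swapSigns σ z)).2 i = (swapSigns σ z i).2 := rfl
        rw [h1, h2]
        by_cases h : σ i <;> simp [swapSigns, h]
      simp only [Set.mem_preimage, hG, Set.mem_ofPred_eq, hsum, Finset.mem_coe]
    have hcard := card_exists_halfspace_lt_abs_signSum_le (fun i => (z i).1) (fun i => (z i).2)
      hL hn (F : Set (EuclideanSpace ℝ (Fin d) × ℝ))
    simp only [Set.indicator_apply, hmem]
    rw [Finset.sum_boole, ← ENNReal.ofReal_natCast]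
    exact ENNReal.ofReal_le_ofReal hcard
  have htotal : (2 : ℝ≥0∞) ^ n * M (e ⁻¹' G) ≤ 2 ^ n * ENNReal.ofReal (2 * Real.exp (-L)) := by
    calc (2 : ℝ≥0∞) ^ n * M (e ⁻¹' G)
        = ∑ σ : Fin n → Bool, M (swapSigns σ ⁻¹' (e ⁻¹' G)) := by
          simp [hswap]
      _ = ∫⁻ z, ∑ σ : Fin n → Bool,
            (swapSigns σ ⁻¹' (e ⁻¹' G)).indicator (fun _ => (1 : ℝ≥0∞)) z ∂M := by
          have hms (σ : Fin n → Bool) : MeasurableSet (swapSigns σ ⁻¹' (e ⁻¹' G)) :=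
            (measurePreserving_swapSigns R σ).measurable hG'm
          rw [lintegral_finsetSum _ fun σ _ => measurable_const.indicator (hms σ)]
          exact Finset.sum_congr rfl fun σ _ => by rw [lintegral_indicator_const (hms σ), one_mul]
      _ ≤ ∫⁻ _, ENNReal.ofReal (2 ^ n * (2 * Real.exp (-L))) ∂M := lintegral_mono hpoint
      _ = 2 ^ n * ENNReal.ofReal (2 * Real.exp (-L)) := by
          rw [lintegral_const, measure_univ, mul_one, ENNReal.ofReal_mul (by positivity),
            ENNReal.ofReal_pow (by norm_num)]
          simp
  exact (ENNReal.mul_le_mul_iff_right (by simp) (by simp)).1 htotal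

/-- If a halfspace deviates by more than `3 * r` on `x`, an independent sample deviates by less than
`r` on it with probability at least `1 / 2`, and then the two counts differ by more than `2 * r`.
Thus the probability at most doubles in passing to the ghost event. -/
lemma measure_exists_finset_deviation_le (R : Measure (EuclideanSpace ℝ (Fin d)))
    [IsProbabilityMeasure R] {L : ℝ} (hL : 0 ≤ L) (hn : 0 < n)
    (F : Finset (EuclideanSpace ℝ (Fin d) × ℝ)) :
    (Measure.pi fun _ : Fin n => R) {x | ∃ q ∈ F, 3 * chainScale d n L <
        |count x (halfspace q.1 q.2) - n * R.real (halfspace q.1 q.2)|} ≤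
      ENNReal.ofReal (4 * Real.exp (-L)) := by
  set r := chainScale d n L with hr
  have hn' : (0 : ℝ) < n := by exact_mod_cast hn
  have hr0 : 0 < r := by
    rw [hr, chainScale]
    positivity
  have hr2 : (n : ℝ) ≤ 2 * r ^ 2 := by
    have h1 : r ^ 2 = 36 * (2 * n * (5 * (d + 1) + L)) := by
      rw [hr, chainScale, mul_pow, Real.sq_sqrt (by positivity)]
      norm_num
    have h2 : (1 : ℝ) ≤ 5 * (d + 1) + L := by
      have : (0 : ℝ) ≤ d := by positivity
      linarith
    rw [h1]
    nlinarith
  set B : Set (Fin n → EuclideanSpace ℝ (Fin d)) := {x | ∃ q ∈ F, 3 * r <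
        |count x (halfspace q.1 q.2) - n * R.real (halfspace q.1 q.2)|} with hB
  have hBm : MeasurableSet B := by
    have : B = ⋃ q ∈ F, {x | 3 * r <
        |count x (halfspace q.1 q.2) - n * R.real (halfspace q.1 q.2)|} := by
      ext p
      simp [hB]
    rw [this]
    refine Finset.measurableSet_biUnion _ fun q _ => measurableSet_lt measurable_const ?_
    exact ((measurable_count (measurableSet_halfspace q.1 q.2)).sub_const _).abs
  have hghost := measure_ghost_le R hL hn F
  rw [← hr] at hghost
  set G : Set ((Fin n → EuclideanSpace ℝ (Fin d)) × (Fin n → EuclideanSpace ℝ (Fin d))) :=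
    {p | ∃ q ∈ F, 2 * r < |count p.1 (halfspace q.1 q.2) - count p.2 (halfspace q.1 q.2)|}
    with hG
  have hsection : ∀ x ∈ B, 1 / 2 ≤ (Measure.pi fun _ : Fin n => R) (Prod.mk x ⁻¹' G) := by
    rintro x ⟨q, hq, hxq⟩
    have hcheb := measure_le_abs_count_sub_le R (measurableSet_halfspace q.1 q.2) hr0 hr2
    set D : Set (Fin n → EuclideanSpace ℝ (Fin d)) :=
      {x | r ≤ |count x (halfspace q.1 q.2) - n * R.real (halfspace q.1 q.2)|} with hD
    have hsub : Dᶜ ⊆ Prod.mk x ⁻¹' G := by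
      intro x' hx'
      simp only [hD, Set.mem_compl_iff, Set.mem_ofPred_eq, not_le] at hx'
      refine ⟨q, hq, ?_⟩
      have h1 := abs_sub_le (count x (halfspace q.1 q.2)) (count x' (halfspace q.1 q.2))
        (n * R.real (halfspace q.1 q.2))
      dsimp only
      linarith
    have hDm : MeasurableSet D := measurableSet_le measurable_const
      ((measurable_count (measurableSet_halfspace q.1 q.2)).sub_const _).abs
    refine le_trans ?_ (measure_mono hsub)
    rw [prob_compl_eq_one_sub hDm]
    have : (1 / 2 : ℝ≥0∞) = 1 - 1 / 2 := by
      rw [one_div, ENNReal.one_sub_inv_two]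
    rw [this]
    exact tsub_le_tsub_left hcheb 1
  have hhalf : 1 / 2 * (Measure.pi fun _ : Fin n => R) B ≤
      ((Measure.pi fun _ : Fin n => R).prod (Measure.pi fun _ : Fin n => R)) G := by
    calc 1 / 2 * (Measure.pi fun _ : Fin n => R) B
        = ∫⁻ x, B.indicator (fun _ => 1 / 2) x ∂(Measure.pi fun _ : Fin n => R) := by
          rw [lintegral_indicator_const hBm]
      _ ≤ ∫⁻ x, (Measure.pi fun _ : Fin n => R) (Prod.mk x ⁻¹' G)
            ∂(Measure.pi fun _ : Fin n => R) := by
          refine lintegral_mono fun x => ?_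
          by_cases hx : x ∈ B
          · simpa [hx] using hsection x hx
          · simp [hx]
      _ = _ := (Measure.prod_apply (measurableSet_ghost F _)).symm
  have h2 : (Measure.pi fun _ : Fin n => R) B = 2 * (1 / 2 * (Measure.pi fun _ : Fin n => R) B) := by
    rw [← mul_assoc, one_div, ENNReal.mul_inv_cancel (by simp) (by simp), one_mul]
  rw [h2, show 4 * Real.exp (-L) = 2 * (2 * Real.exp (-L)) by ring,
    ENNReal.ofReal_mul (by norm_num), ENNReal.ofReal_ofNat]
  gcongr
  exact hhalf.trans hghost

/-- The points of the sample for which some halfspace of a fixed countable dense family has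
frequency far from its mass. -/
def deviationSet (R : Measure (EuclideanSpace ℝ (Fin d))) (n : ℕ) (L : ℝ) :
    Set (Fin n → EuclideanSpace ℝ (Fin d)) :=
  ⋃ k : ℕ, {x | 3 * chainScale d n L <
    |count x (halfspace (TopologicalSpace.denseSeq (EuclideanSpace ℝ (Fin d) × ℝ) k).1
      (TopologicalSpace.denseSeq (EuclideanSpace ℝ (Fin d) × ℝ) k).2) -
      n * R.real (halfspace (TopologicalSpace.denseSeq (EuclideanSpace ℝ (Fin d) × ℝ) k).1
      (TopologicalSpace.denseSeq (EuclideanSpace ℝ (Fin d) × ℝ) k).2)|}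

lemma measurableSet_deviationSet (R : Measure (EuclideanSpace ℝ (Fin d))) (n : ℕ) (L : ℝ) :
    MeasurableSet (deviationSet R n L) :=
  MeasurableSet.iUnion fun _ => measurableSet_lt measurable_const
    ((measurable_count (measurableSet_halfspace _ _)).sub_const _).abs

lemma measure_deviationSet_le (R : Measure (EuclideanSpace ℝ (Fin d)))
    [IsProbabilityMeasure R] {L : ℝ} (hL : 0 ≤ L) (hn : 0 < n) :
    (Measure.pi fun _ : Fin n => R) (deviationSet R n L) ≤ ENNReal.ofReal (4 * Real.exp (-L)) := by
  classical
  rw [deviationSet, measure_iUnion_eq_iSup_accumulate]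
  refine iSup_le fun k => le_trans (measure_mono ?_) (measure_exists_finset_deviation_le R hL hn
    ((Finset.range (k + 1)).image (TopologicalSpace.denseSeq (EuclideanSpace ℝ (Fin d) × ℝ))))
  intro x hx
  obtain ⟨j, hj, hx⟩ := Set.mem_accumulate.1 hx
  exact ⟨_, Finset.mem_image_of_mem _ (Finset.mem_range.2 (Nat.lt_succ_of_le hj)), hx⟩

/-- The approximants aim at the shifted level `t + 2 * η k` with error below `η k ^ 2`. The outward
shift dominates the error, so boundary points are eventually inside; it tends to `0`, so outside
points are eventually outside. -/
lemma exists_seq_dense_halfspace (u : EuclideanSpace ℝ (Fin d)) (t : ℝ) :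
    ∃ j : ℕ → ℕ, ∀ y, ∀ᶠ k in Filter.atTop,
      y ∈ halfspace (TopologicalSpace.denseSeq (EuclideanSpace ℝ (Fin d) × ℝ) (j k)).1
        (TopologicalSpace.denseSeq (EuclideanSpace ℝ (Fin d) × ℝ) (j k)).2 ↔ y ∈ halfspace u t := by
  set D := TopologicalSpace.denseSeq (EuclideanSpace ℝ (Fin d) × ℝ)
  let η : ℕ → ℝ := fun k => 1 / ((k : ℝ) + 1)
  have hη0 (k) : 0 < η k := by positivity
  have hη1 (k) : η k ≤ 1 := by
    rw [div_le_one (by positivity)]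
    have : (0 : ℝ) ≤ k := by positivity
    linarith
  have hη : Filter.Tendsto η Filter.atTop (nhds 0) := tendsto_one_div_add_atTop_nhds_zero_nat
  have hex (k : ℕ) : ∃ j, dist (u, t + 2 * η k) (D j) < η k ^ 2 :=
    (TopologicalSpace.denseRange_denseSeq _).exists_dist_lt _ (by have := hη0 k; positivity)
  choose j hj using hex
  have hju (k) : ‖u - (D (j k)).1‖ < η k ^ 2 := by
    rw [← dist_eq_norm]
    exact (le_max_left _ _).trans_lt (hj k)
  have hjt (k) : |t + 2 * η k - (D (j k)).2| < η k ^ 2 := by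
    rw [← Real.dist_eq]
    exact (le_max_right _ _).trans_lt (hj k)
  refine ⟨j, fun y => ?_⟩
  have hη2 (k) : η k ^ 2 ≤ η k := by nlinarith [hη0 k, hη1 k]
  have hinner (k) : |inner ℝ y u - inner ℝ y (D (j k)).1| ≤ ‖y‖ * η k ^ 2 := by
    rw [← inner_sub_right]
    exact (abs_real_inner_le_norm _ _).trans (by gcongr; exact (hju k).le)
  by_cases hy : y ∈ halfspace u t
  · filter_upwards [hη.eventually (gt_mem_nhds (show (0 : ℝ) < 1 / (‖y‖ + 1) by positivity))]
      with k hk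
    refine iff_of_true ?_ hy
    have h1 := abs_le.1 (hinner k)
    have h2 := abs_lt.1 (hjt k)
    have hy' : inner ℝ y u ≤ t := hy
    have h3 : ‖y‖ * η k ^ 2 ≤ η k := by
      have : η k * (‖y‖ + 1) < 1 := (lt_div_iff₀ (by positivity)).1 hk
      nlinarith [hη0 k, norm_nonneg y]
    change inner ℝ y (D (j k)).1 ≤ (D (j k)).2
    linarith [hη2 k]
  · have hy' : t < inner ℝ y u := not_le.1 hy
    filter_upwards [hη.eventually (gt_mem_nhds
      (show (0 : ℝ) < (inner ℝ y u - t) / (‖y‖ + 3) by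
        have : 0 < inner ℝ y u - t := by linarith
        positivity))] with k hk
    refine iff_of_false (fun h : inner ℝ y (D (j k)).1 ≤ (D (j k)).2 => ?_) hy
    have h1 := abs_le.1 (hinner k)
    have h2 := abs_lt.1 (hjt k)
    rw [lt_div_iff₀ (by positivity)] at hk
    nlinarith [hη2 k, norm_nonneg y, hη0 k]

/-- Outside of `deviationSet` the deviation bound holds for all halfspaces. -/
lemma abs_count_sub_le_of_notMem_deviationSet {R : Measure (EuclideanSpace ℝ (Fin d))}
    [IsProbabilityMeasure R] {L : ℝ} {x : Fin n → EuclideanSpace ℝ (Fin d)}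
    (hx : x ∉ deviationSet R n L) (u : EuclideanSpace ℝ (Fin d)) (t : ℝ) :
    |count x (halfspace u t) - n * R.real (halfspace u t)| ≤ 3 * chainScale d n L := by
  simp only [deviationSet, Set.mem_iUnion, Set.mem_ofPred_eq, not_exists, not_lt] at hx
  obtain ⟨j, hj⟩ := exists_seq_dense_halfspace u t
  set D := TopologicalSpace.denseSeq (EuclideanSpace ℝ (Fin d) × ℝ)
  have hR : Filter.Tendsto (fun k => R.real (halfspace (D (j k)).1 (D (j k)).2)) Filter.atTop
      (nhds (R.real (halfspace u t))) := by
    refine (ENNReal.tendsto_toReal (measure_ne_top _ _)).comp ?_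
    exact tendsto_measure_of_tendsto_indicator_of_isFiniteMeasure Filter.atTop R
      (fun k => measurableSet_halfspace _ _) hj
  have hcount : ∀ᶠ k in Filter.atTop,
      count x (halfspace (D (j k)).1 (D (j k)).2) = count x (halfspace u t) := by
    filter_upwards [Filter.eventually_all.2 fun i => hj (x i)] with k hk
    refine Finset.sum_congr rfl fun i _ => ?_
    by_cases h : x i ∈ halfspace u t
    · simp [h, (hk i).2 h]
    · simp [h, mt (hk i).1 h]
  have hlim := ((tendsto_const_nhds (x := count x (halfspace u t))).congr'
    (hcount.mono fun _ h => h.symm)).sub (hR.const_mul (n : ℝ))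
  exact le_of_tendsto hlim.abs (Filter.Eventually.of_forall fun k => hx (j k))

end Symmetrization

end HalfspaceDepth

namespace HalfspaceDepth

/-! ### The barycenter of a compact convex set. -/

section Barycenter

variable {d : ℕ}

/-- Translated isometrically into its direction space, the set is compact with nonempty interior,
and there the Hausdorff measure of full dimension is positive on open sets and finite on compact
ones. -/
lemma hausdorffMeasure_finrank_vectorSpan_pos_lt_top {S : Set (EuclideanSpace ℝ (Fin d))}
    (hne : S.Nonempty) (hcpt : IsCompact S) (hconv : Convex ℝ S) :
    Measure.hausdorffMeasure (Module.finrank ℝ (vectorSpan ℝ S) : ℝ) S ≠ 0 ∧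
      Measure.hausdorffMeasure (Module.finrank ℝ (vectorSpan ℝ S) : ℝ) S ≠ ∞ := by
  obtain ⟨p, hp⟩ := hne
  set V := vectorSpan ℝ S with hV
  let f : V →ᵃ[ℝ] EuclideanSpace ℝ (Fin d) :=
    V.subtype.toAffineMap + AffineMap.const ℝ V p
  have hf (v : V) : f v = v + p := rfl
  have hiso : Isometry f := Isometry.of_dist_eq fun v w => by
    rw [hf, hf, dist_add_right]
    rfl
  set T : Set V := f ⁻¹' S with hT
  have himage : f '' T = S := by
    refine Set.Subset.antisymm (Set.image_preimage_subset _ _) fun s hs => ?_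
    have h1 : (⟨s - p, vsub_mem_vectorSpan ℝ hs hp⟩ : V) ∈ T := by
      simp [hT, hf, hs]
    exact ⟨_, h1, by simp [hf]⟩
  have hTne : T.Nonempty := ⟨0, by simp [hT, hf, hp]⟩
  have hTcpt : IsCompact T := hiso.isClosedEmbedding.isCompact_preimage hcpt
  have hTconv : Convex ℝ T := hconv.affine_preimage f
  have hspan : affineSpan ℝ T = ⊤ := by
    rw [AffineSubspace.affineSpan_eq_top_iff_vectorSpan_eq_top_of_nonempty ℝ _ _ hTne]
    have h1 := AffineMap.map_vectorSpan (k := ℝ) (s := T) f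
    rw [himage] at h1
    have h2 : f.linear = V.subtype := by
      ext v
      simp [f]
    rw [h2] at h1
    refine Submodule.map_injective_of_injective V.injective_subtype ?_
    rw [h1, Submodule.map_top, Submodule.range_subtype]
  have hint := hTconv.interior_nonempty_iff_affineSpan_eq_top.2 hspan
  have hmeas : Measure.hausdorffMeasure (Module.finrank ℝ V : ℝ) S =
      Measure.hausdorffMeasure (Module.finrank ℝ V : ℝ) T := by
    rw [← hiso.hausdorffMeasure_image (Or.inl (Nat.cast_nonneg _)), himage]
  rw [hmeas]
  exact ⟨(Measure.measure_pos_of_nonempty_interior _ hint).ne', hTcpt.measure_lt_top.ne⟩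

/-- The barycenter of a nonempty compact convex set belongs to it. -/
lemma barycenter_mem {S : Set (EuclideanSpace ℝ (Fin d))}
    (hne : S.Nonempty) (hcpt : IsCompact S) (hconv : Convex ℝ S) : barycenter S ∈ S := by
  obtain ⟨h0, htop⟩ := hausdorffMeasure_finrank_vectorSpan_pos_lt_top hne hcpt hconv
  refine hconv.set_average_mem hcpt.isClosed h0 htop (ae_restrict_mem hcpt.measurableSet) ?_
  obtain ⟨C, hC⟩ := hcpt.isBounded.exists_norm_le
  refine Measure.integrableOn_of_bounded (M := C) htop measurable_id.aestronglyMeasurable ?_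
  filter_upwards [ae_restrict_mem hcpt.measurableSet] with x hx
  exact hC x hx

end Barycenter

/-! ### Existence of deepest points and stability of depth. -/

section Median

variable {d : ℕ} {P : Measure (EuclideanSpace ℝ (Fin d))}

lemma depth_le (x : EuclideanSpace ℝ (Fin d)) (P : Measure (EuclideanSpace ℝ (Fin d)))
    {u : EuclideanSpace ℝ (Fin d)} (hu : ‖u‖ = 1) :
    depth x P ≤ P.real (halfspace u (inner ℝ x u)) :=
  ciInf_le ⟨0, by rintro _ ⟨v, rfl⟩; exact measureReal_nonneg⟩
    (⟨u, by simpa using hu⟩ : Metric.sphere (0 : EuclideanSpace ℝ (Fin d)) 1)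

lemma le_depth [NeZero d] {x : EuclideanSpace ℝ (Fin d)} {a : ℝ}
    (h : ∀ u, ‖u‖ = 1 → a ≤ P.real (halfspace u (inner ℝ x u))) : a ≤ depth x P := by
  have : Nonempty (Metric.sphere (0 : EuclideanSpace ℝ (Fin d)) 1) :=
    (NormedSpace.sphere_nonempty.2 zero_le_one).to_subtype
  exact le_ciInf fun u => h u (by simp)

lemma depth_le_mul_add [NeZero d] {P₁ P₂ : Measure (EuclideanSpace ℝ (Fin d))} {a b : ℝ}
    (ha : 0 < a) (h : ∀ u t, P₁.real (halfspace u t) ≤ a * P₂.real (halfspace u t) + b)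
    (x : EuclideanSpace ℝ (Fin d)) : depth x P₁ ≤ a * depth x P₂ + b := by
  have : (depth x P₁ - b) / a ≤ depth x P₂ := by
    refine le_depth fun u hu => ?_
    rw [div_le_iff₀ ha]
    linarith [depth_le x P₁ hu, h u (inner ℝ x u)]
  rw [div_le_iff₀ ha] at this
  linarith

lemma measureReal_halfspace_mono [IsProbabilityMeasure P] (u : EuclideanSpace ℝ (Fin d)) :
    Monotone fun t => P.real (halfspace u t) := fun _ _ hst =>
  measureReal_mono fun _ hy => le_trans hy hst

lemma tendsto_measureReal_of_eventually_mem_iff [IsProbabilityMeasure P]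
    {A : ℕ → Set (EuclideanSpace ℝ (Fin d))} {B : Set (EuclideanSpace ℝ (Fin d))}
    (hA : ∀ k, MeasurableSet (A k)) (h : ∀ y, ∀ᶠ k in Filter.atTop, y ∈ A k ↔ y ∈ B) :
    Filter.Tendsto (fun k => P.real (A k)) Filter.atTop (nhds (P.real B)) :=
  (ENNReal.tendsto_toReal (measure_ne_top _ _)).comp
    (tendsto_measure_of_tendsto_indicator_of_isFiniteMeasure Filter.atTop P hA h)

lemma exists_gt_measureReal_halfspace_lt [IsProbabilityMeasure P]
    {u : EuclideanSpace ℝ (Fin d)} {t a : ℝ} (h : P.real (halfspace u t) < a) :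
    ∃ s, t < s ∧ P.real (halfspace u s) < a := by
  have hlim := tendsto_measureReal_of_eventually_mem_iff (P := P)
    (A := fun k : ℕ => halfspace u (t + 1 / ((k : ℝ) + 1))) (B := halfspace u t)
    (fun k => measurableSet_halfspace _ _) (fun y => by
      by_cases hy : y ∈ halfspace u t
      · refine Filter.Eventually.of_forall fun k => iff_of_true ?_ hy
        have : (0 : ℝ) < 1 / ((k : ℝ) + 1) := by positivity
        exact le_trans (show inner ℝ y u ≤ t from hy) (by linarith)
      · have hy' : 0 < inner ℝ y u - t := sub_pos.2 (not_le.1 hy)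
        filter_upwards [tendsto_one_div_add_atTop_nhds_zero_nat.eventually
          (gt_mem_nhds hy')] with k hk
        refine iff_of_false (fun h : inner ℝ y u ≤ t + 1 / ((k : ℝ) + 1) => ?_) hy
        linarith)
  obtain ⟨k, hk⟩ := (hlim.eventually (gt_mem_nhds h)).exists
  exact ⟨_, by simp only [lt_add_iff_pos_right]; positivity, hk⟩

lemma exists_measureReal_compl_closedBall_lt (P : Measure (EuclideanSpace ℝ (Fin d)))
    [IsProbabilityMeasure P] {a : ℝ} (ha : 0 < a) :
    ∃ r, P.real (Metric.closedBall 0 r)ᶜ < a := by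
  have hlim := tendsto_measureReal_of_eventually_mem_iff (P := P)
    (A := fun k : ℕ => (Metric.closedBall 0 (k : ℝ))ᶜ) (B := ∅)
    (fun k => measurableSet_closedBall.compl) (fun y => by
      obtain ⟨k, hk⟩ := exists_nat_ge ‖y‖
      filter_upwards [Filter.eventually_ge_atTop k] with j hj
      have : (k : ℝ) ≤ j := by exact_mod_cast hj
      simp
      linarith)
  rw [measureReal_empty] at hlim
  obtain ⟨k, hk⟩ := (hlim.eventually (gt_mem_nhds ha)).exists
  exact ⟨k, hk⟩

/-- Since halfspace mass is monotone and right-continuous in the level, each set in this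
intersection is a closed convex set. -/
lemma setOf_le_depth_eq [NeZero d] (P : Measure (EuclideanSpace ℝ (Fin d))) (a : ℝ) :
    {x | a ≤ depth x P} = ⋂ u : Metric.sphere (0 : EuclideanSpace ℝ (Fin d)) 1,
      (fun x => inner ℝ x (u : EuclideanSpace ℝ (Fin d))) ⁻¹'
        {t | a ≤ P.real (halfspace (u : EuclideanSpace ℝ (Fin d)) t)} := by
  ext x
  simp only [Set.mem_iInter, Set.mem_preimage]
  exact ⟨fun h u => le_trans (show a ≤ depth x P from h) (depth_le x P (by simp)),
    fun h => le_depth fun u hu => h ⟨u, by simpa using hu⟩⟩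

lemma isClosed_setOf_le_measureReal_halfspace [IsProbabilityMeasure P]
    (u : EuclideanSpace ℝ (Fin d)) (a : ℝ) : IsClosed {t | a ≤ P.real (halfspace u t)} := by
  rw [← isOpen_compl_iff, isOpen_iff_mem_nhds]
  intro t ht
  obtain ⟨s, hts, hs⟩ := exists_gt_measureReal_halfspace_lt
    (not_le.1 (show ¬ a ≤ P.real (halfspace u t) from ht))
  filter_upwards [gt_mem_nhds hts] with t' ht'
  exact not_le.2 ((measureReal_halfspace_mono u ht'.le).trans_lt hs)

lemma isClosed_setOf_le_depth [NeZero d] [IsProbabilityMeasure P] (a : ℝ) :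
    IsClosed {x | a ≤ depth x P} := by
  rw [setOf_le_depth_eq]
  exact isClosed_iInter fun u =>
    (isClosed_setOf_le_measureReal_halfspace _ a).preimage (by fun_prop)

lemma convex_setOf_le_depth [NeZero d] [IsProbabilityMeasure P] (a : ℝ) :
    Convex ℝ {x | a ≤ depth x P} := by
  rw [setOf_le_depth_eq]
  refine convex_iInter fun u => Convex.is_linear_preimage ?_ (isLinearMap_inner_left _)
  have : IsUpperSet {t | a ≤ P.real (halfspace (u : EuclideanSpace ℝ (Fin d)) t)} :=
    fun s t hst hs => le_trans hs (measureReal_halfspace_mono _ hst)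
  exact this.ordConnected.convex

/-- Boundedness is tightness: the halfspace through a distant `x` facing away from the origin misses
a ball carrying more than `1 - a` of the mass. -/
lemma isCompact_setOf_le_depth [NeZero d] [IsProbabilityMeasure P] {a : ℝ} (ha : 0 < a) :
    IsCompact {x | a ≤ depth x P} := by
  refine Metric.isCompact_of_isClosed_isBounded (isClosed_setOf_le_depth a) ?_
  obtain ⟨r, hr⟩ := exists_measureReal_compl_closedBall_lt P ha
  refine (Metric.isBounded_closedBall (x := (0 : EuclideanSpace ℝ (Fin d))) (r := max r 0)).subset
    fun x hx => ?_
  by_contra hxr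
  rw [mem_closedBall_zero_iff, not_le, max_lt_iff] at hxr
  have hu : ‖(-‖x‖⁻¹) • x‖ = 1 := by
    rw [norm_smul, norm_neg, norm_inv, norm_norm, inv_mul_cancel₀ hxr.2.ne']
  have h1 : inner ℝ x ((-‖x‖⁻¹) • x) = -‖x‖ := by
    rw [real_inner_smul_right, real_inner_self_eq_norm_sq]
    field_simp
  have h2 : halfspace ((-‖x‖⁻¹) • x) (inner ℝ x ((-‖x‖⁻¹) • x)) ⊆ (Metric.closedBall 0 r)ᶜ := by
    intro y hy hyr
    rw [mem_closedBall_zero_iff] at hyr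
    have h3 : inner ℝ y ((-‖x‖⁻¹) • x) ≤ -‖x‖ := h1 ▸ hy
    have h4 := abs_le.1 (abs_real_inner_le_norm y ((-‖x‖⁻¹) • x))
    rw [hu, mul_one] at h4
    linarith
  have h5 := (depth_le x P hu).trans (measureReal_mono h2)
  have h6 : a ≤ depth x P := hx
  linarith

/-- **Centerpoint theorem**: some point has depth at least `1 / (d + 1)`. -/
lemma exists_inv_le_depth [NeZero d] (P : Measure (EuclideanSpace ℝ (Fin d)))
    [IsProbabilityMeasure P] : ∃ x, ((d : ℝ) + 1)⁻¹ ≤ depth x P := by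
  set c : ℝ := ((d : ℝ) + 1)⁻¹ with hc
  have hc0 : 0 < c := by positivity
  -- Helly's theorem applies to this family: at most `d + 1` complements of mass below `1 / (d + 1)`
  -- cannot cover the space. Compactness handles the infinite family.
  let ι := {K : Set (EuclideanSpace ℝ (Fin d)) // Convex ℝ K ∧ IsCompact K ∧ P.real Kᶜ < c}
  obtain ⟨x, hx⟩ := Convex.helly_theorem_compact' (𝕜 := ℝ) (F := fun K : ι => K.1)
    (fun K => K.2.1) (fun K => K.2.2.1) (fun I hI => by
      rw [finrank_euclideanSpace, Fintype.card_fin] at hI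
      by_contra hempty
      rw [Set.not_nonempty_iff_eq_empty] at hempty
      rcases I.eq_empty_or_nonempty with rfl | hIne
      · simp at hempty
      have h1 : P.real (⋃ K ∈ I, (K : Set (EuclideanSpace ℝ (Fin d)))ᶜ) = 1 := by
        have : (⋃ K ∈ I, (K : Set (EuclideanSpace ℝ (Fin d)))ᶜ) = Set.univ := by
          rw [← Set.compl_empty, ← hempty]
          simp only [Set.compl_iInter]
        rw [this, probReal_univ]
      have h2 : P.real (⋃ K ∈ I, (K : Set (EuclideanSpace ℝ (Fin d)))ᶜ) ≤
          ∑ K ∈ I, P.real (K : Set (EuclideanSpace ℝ (Fin d)))ᶜ :=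
        measureReal_biUnion_finset_le _ _
      have h3 : ∑ K ∈ I, P.real (K : Set (EuclideanSpace ℝ (Fin d)))ᶜ < ∑ K ∈ I, c :=
        Finset.sum_lt_sum_of_nonempty hIne fun K _ => K.2.2.2
      rw [Finset.sum_const, nsmul_eq_mul] at h3
      have h4 : (I.card : ℝ) * c ≤ (d + 1) * c := by
        gcongr
        exact_mod_cast hI
      rw [hc, mul_inv_cancel₀ (by positivity)] at h4
      linarith)
  refine ⟨x, le_depth fun u _ => ?_⟩
  by_contra! hlt
  -- Right-continuity leaves room to push the hyperplane strictly past `x`; the opposite closed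
  -- halfspace, cut by a large ball, is then a member of the family missing `x`.
  obtain ⟨s, hs, hsc⟩ := exists_gt_measureReal_halfspace_lt hlt
  obtain ⟨r, hr⟩ := exists_measureReal_compl_closedBall_lt P (sub_pos.2 hsc)
  have hKconv : Convex ℝ (Metric.closedBall 0 r ∩ {y | s ≤ inner ℝ y u}) :=
    (convex_closedBall 0 r).inter (convex_halfSpace_ge (isLinearMap_inner_left u) s)
  have hKcpt : IsCompact (Metric.closedBall 0 r ∩ {y | s ≤ inner ℝ y u}) :=
    (isCompact_closedBall 0 r).inter_right (isClosed_le continuous_const (by fun_prop))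
  have hKc : P.real (Metric.closedBall 0 r ∩ {y | s ≤ inner ℝ y u})ᶜ < c := by
    have h1 : (Metric.closedBall 0 r ∩ {y | s ≤ inner ℝ y u})ᶜ ⊆
        (Metric.closedBall 0 r)ᶜ ∪ halfspace u s := by
      rw [Set.compl_inter]
      exact Set.union_subset_union_right _ fun y (hy : ¬ s ≤ inner ℝ y u) =>
        (not_le.1 hy).le
    have h2 := (measureReal_mono (μ := P) h1).trans (measureReal_union_le _ _)
    linarith
  have h := (Set.mem_iInter.1 hx ⟨_, hKconv, hKcpt, hKc⟩).2
  exact absurd hs (not_lt.2 h)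

lemma exists_forall_depth_le [NeZero d] (P : Measure (EuclideanSpace ℝ (Fin d)))
    [IsProbabilityMeasure P] : ∃ x, 0 < depth x P ∧ ∀ y, depth y P ≤ depth x P := by
  obtain ⟨z, hz⟩ := exists_inv_le_depth P
  have hc : (0 : ℝ) < ((d : ℝ) + 1)⁻¹ := by positivity
  have husc : UpperSemicontinuous fun x => depth x P :=
    upperSemicontinuous_iff_isClosed_preimage.2 fun a => isClosed_setOf_le_depth a
  obtain ⟨x, hx, hmax⟩ := (husc.upperSemicontinuousOn _).exists_isMaxOn ⟨z, hz⟩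
    (isCompact_setOf_le_depth hc)
  refine ⟨x, hc.trans_le hx, fun y => ?_⟩
  by_cases hy : ((d : ℝ) + 1)⁻¹ ≤ depth y P
  · exact hmax hy
  · exact (not_le.1 hy).le.trans hx

/-- The halfspace median has maximal depth. -/
lemma median_mem_medianSet [NeZero d] (P : Measure (EuclideanSpace ℝ (Fin d)))
    [IsProbabilityMeasure P] : median P ∈ medianSet P := by
  obtain ⟨x, hx0, hx⟩ := exists_forall_depth_le P
  have hset : medianSet P = {y | depth x P ≤ depth y P} :=
    Set.ext fun y => ⟨fun hy => hy x, fun hy z => (hx z).trans hy⟩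
  refine barycenter_mem ⟨x, hx⟩ ?_ ?_ <;> rw [hset]
  · exact isCompact_setOf_le_depth hx0
  · exact convex_setOf_le_depth _

lemma isProbabilityMeasure_contaminated (P Q : Measure (EuclideanSpace ℝ (Fin d)))
    [IsProbabilityMeasure P] [IsProbabilityMeasure Q] {ε : ℝ} (h0 : 0 ≤ ε) (h1 : ε ≤ 1) :
    IsProbabilityMeasure (contaminated ε P Q) := by
  constructor
  simp only [contaminated, Measure.coe_add, Measure.coe_smul, Pi.add_apply, Pi.smul_apply,
    measure_univ, smul_eq_mul, mul_one]
  rw [← ENNReal.ofReal_add (by linarith) h0]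
  simp

lemma contaminated_real (P Q : Measure (EuclideanSpace ℝ (Fin d)))
    [IsProbabilityMeasure P] [IsProbabilityMeasure Q] {ε : ℝ} (h0 : 0 ≤ ε) (h1 : ε ≤ 1)
    (H : Set (EuclideanSpace ℝ (Fin d))) :
    (contaminated ε P Q).real H = (1 - ε) * P.real H + ε * Q.real H := by
  rw [contaminated, measureReal_add_apply (by simp [ENNReal.mul_eq_top])
    (by simp [ENNReal.mul_eq_top]), measureReal_ennreal_smul_apply,
    measureReal_ennreal_smul_apply, ENNReal.toReal_ofReal (by linarith), ENNReal.toReal_ofReal h0]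

lemma isProbabilityMeasure_empiricalMeasure {n : ℕ} (hn : 0 < n)
    (x : Fin n → EuclideanSpace ℝ (Fin d)) : IsProbabilityMeasure (empiricalMeasure x) := by
  constructor
  simp only [empiricalMeasure, Measure.coe_smul, Pi.smul_apply, Measure.coe_finsetSum,
    Finset.sum_apply, measure_univ, Finset.sum_const, Finset.card_univ, Fintype.card_fin,
    smul_eq_mul, nsmul_eq_mul, mul_one]
  exact ENNReal.inv_mul_cancel (by simpa using hn.ne') (ENNReal.natCast_ne_top n)

lemma empiricalMeasure_real {n : ℕ} (x : Fin n → EuclideanSpace ℝ (Fin d))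
    {H : Set (EuclideanSpace ℝ (Fin d))} (hH : MeasurableSet H) :
    (empiricalMeasure x).real H = count x H / n := by
  have h1 (i : Fin n) : (Measure.dirac (x i) H).toReal = H.indicator 1 (x i) := by
    rw [Measure.dirac_apply' _ hH]
    by_cases h : x i ∈ H <;> simp [h]
  rw [empiricalMeasure, measureReal_ennreal_smul_apply, measureReal_def, Measure.coe_finsetSum,
    Finset.sum_apply, ENNReal.toReal_sum fun i _ => measure_ne_top _ _]
  simp only [h1, ENNReal.toReal_inv, ENNReal.toReal_natCast, count]
  rw [inv_mul_eq_div]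

/-- If the halfspace masses of `P'` are close to those of the contaminated distribution, then the
median of `P'` is almost as deep in `P` as the median of `P`. -/
lemma abs_depth_median_sub_le [NeZero d] {P Q P' : Measure (EuclideanSpace ℝ (Fin d))}
    [IsProbabilityMeasure P] [IsProbabilityMeasure Q] [IsProbabilityMeasure P'] {ε a : ℝ}
    (h0 : 0 ≤ ε) (h1 : ε < 1 / 3)
    (h : ∀ u t, |P'.real (halfspace u t) - (contaminated ε P Q).real (halfspace u t)| ≤ a) :
    |depth (median P) P - depth (median P') P| ≤ ε / (1 - ε) + 3 * a := by
  have ha : 0 ≤ a := (abs_nonneg _).trans (h 0 0)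
  have hreal := contaminated_real P Q h0 (by linarith)
  have hm := median_mem_medianSet P
  have hm' := median_mem_medianSet P'
  have e1 : (1 - ε) * depth (median P) P ≤ depth (median P) (contaminated ε P Q) := by
    have := depth_le_mul_add (P₁ := P) (P₂ := contaminated ε P Q) (a := (1 - ε)⁻¹) (b := 0)
      (inv_pos.2 (by linarith)) (fun u t => by
        rw [add_zero, inv_mul_eq_div, le_div_iff₀ (by linarith), hreal]
        nlinarith [measureReal_nonneg (μ := Q) (s := halfspace u t)]) (median P)
    rw [add_zero, inv_mul_eq_div, le_div_iff₀ (by linarith)] at this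
    linarith
  have e2 := depth_le_mul_add (P₁ := contaminated ε P Q) (P₂ := P') (a := 1) (b := a) one_pos
    (fun u t => by linarith [(abs_le.1 (h u t)).1]) (median P)
  have e3 := hm' (median P)
  have e4 := depth_le_mul_add (P₁ := P') (P₂ := contaminated ε P Q) (a := 1) (b := a) one_pos
    (fun u t => by linarith [(abs_le.1 (h u t)).2]) (median P')
  have e5 := depth_le_mul_add (P₁ := contaminated ε P Q) (P₂ := P) (a := 1 - ε) (b := ε)
    (by linarith) (fun u t => by
      rw [hreal]
      nlinarith [measureReal_le_one (μ := Q) (s := halfspace u t)]) (median P')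
  rw [abs_of_nonneg (sub_nonneg.2 (hm _))]
  -- Chaining `e1` to `e5` loses `a` twice, on passing to `P'` and back. Afterwards `2 / (1 - ε) ≤
  -- 3` because `ε < 1 / 3`.
  have e6 : depth (median P) P - depth (median P') P ≤ (ε + 2 * a) / (1 - ε) := by
    rw [le_div_iff₀ (by linarith)]
    linarith
  refine e6.trans ?_
  rw [add_div]
  gcongr
  rw [div_le_iff₀ (by linarith)]
  nlinarith

end Median

end HalfspaceDepth

/-! ### Constants and the high-probability event. -/

namespace HalfspaceDepth

/-- Since `d ≥ 1`, `10 * (d + 1) + 4 * L ≤ 25 * d + 4 * L`, whose square root is at most `5 * √d + 2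
* √L`; the prefactor `3 * 3 * 6 = 54` yields `270` and `108`. -/
lemma three_mul_chainScale_div_le {d n : ℕ} (hd : 1 ≤ d) (hn : 1 ≤ n) {L : ℝ} (hL : 0 ≤ L) :
    3 * (3 * chainScale d n (2 * L) / n) ≤ 270 * Real.sqrt (d / n) + 108 * Real.sqrt (L / n) := by
  have hn' : (0 : ℝ) < n := by exact_mod_cast hn
  have hd' : (1 : ℝ) ≤ d := by exact_mod_cast hd
  have h1 : Real.sqrt (2 * n * (5 * (d + 1) + 2 * L)) / n ≤
      5 * Real.sqrt (d / n) + 2 * Real.sqrt (L / n) := by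
    rw [div_le_iff₀ hn']
    refine Real.sqrt_le_iff.2 ⟨by positivity, ?_⟩
    have h2 : Real.sqrt (d / n) ^ 2 = d / n := Real.sq_sqrt (by positivity)
    have h3 : Real.sqrt (L / n) ^ 2 = L / n := Real.sq_sqrt (by positivity)
    have h4 : ((5 * Real.sqrt (d / n) + 2 * Real.sqrt (L / n)) * n) ^ 2 =
        (25 * d + 4 * L) * n + 20 * (Real.sqrt (d / n) * Real.sqrt (L / n)) * n ^ 2 := by
      have : ((5 * Real.sqrt (d / n) + 2 * Real.sqrt (L / n)) * n) ^ 2 =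
        (25 * Real.sqrt (d / n) ^ 2 + 4 * Real.sqrt (L / n) ^ 2) * n ^ 2 +
          20 * (Real.sqrt (d / n) * Real.sqrt (L / n)) * n ^ 2 := by ring
      rw [this, h2, h3]
      field_simp
    have h5 : 0 ≤ 20 * (Real.sqrt (d / n) * Real.sqrt (L / n)) * (n : ℝ) ^ 2 := by positivity
    rw [h4]
    nlinarith
  unfold chainScale
  linear_combination 54 * h1

/-- With high probability all halfspace frequencies are close to the halfspace masses. -/
lemma exists_event_abs_empiricalMeasure_sub_le {d n : ℕ} (hn : 1 ≤ n)
    (R : Measure (EuclideanSpace ℝ (Fin d))) [IsProbabilityMeasure R] {L : ℝ} (hL : 0 ≤ L)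
    {Ω : Type*} [MeasurableSpace Ω] (μ : Measure Ω) [IsProbabilityMeasure μ]
    {X : Fin n → Ω → EuclideanSpace ℝ (Fin d)} (hX : ∀ i, Measurable (X i))
    (hmap : ∀ i, μ.map (X i) = R) (hind : iIndepFun X μ) :
    ∃ A : Set Ω, MeasurableSet A ∧ 1 - 4 * Real.exp (-L) ≤ μ.real A ∧ ∀ ω ∈ A, ∀ u t,
      |(empiricalMeasure fun i => X i ω).real (halfspace u t) - R.real (halfspace u t)| ≤
        3 * chainScale d n L / n := by
  have hn' : (0 : ℝ) < n := by exact_mod_cast hn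
  have hXm : Measurable fun ω i => X i ω := measurable_pi_lambda _ hX
  have hlaw : μ.map (fun ω i => X i ω) = Measure.pi fun _ => R := by
    rw [(iIndepFun_iff_map_fun_eq_pi_map fun i => (hX i).aemeasurable).1 hind]
    simp_rw [hmap]
  have hdev := measurableSet_deviationSet R n L
  have hpre : MeasurableSet ((fun ω i => X i ω) ⁻¹' deviationSet R n L) := hXm hdev
  refine ⟨((fun ω i => X i ω) ⁻¹' deviationSet R n L)ᶜ, hpre.compl, ?_, fun ω hω u t => ?_⟩
  · rw [probReal_compl_eq_one_sub hpre]
    have h1 := measure_deviationSet_le R hL hn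
    rw [← hlaw, Measure.map_apply hXm hdev] at h1
    have h2 := ENNReal.toReal_le_of_le_ofReal (by positivity) h1
    rw [← measureReal_def] at h2
    linarith
  · have h1 := abs_count_sub_le_of_notMem_deviationSet hω u t
    rw [empiricalMeasure_real _ (measurableSet_halfspace u t), le_div_iff₀ hn',
      ← abs_of_pos hn', ← abs_mul, abs_of_pos hn', sub_mul, div_mul_cancel₀ _ hn'.ne',
      mul_comm (R.real _)]
    exact h1

end HalfspaceDepth

theorem mainTheorem7 :
    ∃ C₁ C₂ : ℝ, 0 < C₁ ∧ 0 < C₂ ∧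
      ∀ (d : ℕ), 1 ≤ d →
      ∀ (P Q : Measure (EuclideanSpace ℝ (Fin d))),
        IsProbabilityMeasure P → IsProbabilityMeasure Q →
      ∀ (ε : ℝ), 0 ≤ ε → ε < 1 / 3 →
      ∀ (δ : ℝ), 0 < δ → δ < 1 / 2 →
      ∀ (n : ℕ), 1 ≤ n → Real.sqrt (Real.log (1 / δ) / (2 * n)) < 1 / 3 →
      ∀ (Ω : Type*) [MeasurableSpace Ω] (μ : Measure Ω) [IsProbabilityMeasure μ]
        (X : Fin n → Ω → EuclideanSpace ℝ (Fin d)),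
        (∀ i, Measurable (X i)) →
        (∀ i, μ.map (X i) = HalfspaceDepth.contaminated ε P Q) →
        iIndepFun X μ →
        -- there is a measurable event of probability at least `1 - 2δ` on which the bound holds
        ∃ A : Set Ω, MeasurableSet A ∧ 1 - 2 * δ ≤ μ.real A ∧
          ∀ ω ∈ A,
            |HalfspaceDepth.depth (HalfspaceDepth.median P) P -
              HalfspaceDepth.depth (HalfspaceDepth.sampleMedian fun i => X i ω) P| ≤
              ε / (1 - ε) + C₁ * Real.sqrt (d / n) + C₂ * Real.sqrt (Real.log (1 / δ) / n) := by
  refine ⟨270, 108, by norm_num, by norm_num, ?_⟩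
  intro d hd P Q hP hQ ε hε0 hε1 δ hδ0 hδ1 n hn _ Ω _ μ _ X hX hmap hind
  have : NeZero d := ⟨by omega⟩
  have hR := HalfspaceDepth.isProbabilityMeasure_contaminated P Q hε0 (by linarith)
  have hlog : Real.log 2 ≤ Real.log (1 / δ) :=
    Real.log_le_log (by norm_num) ((le_div_iff₀ hδ0).2 (by linarith))
  have hL : 0 ≤ Real.log (1 / δ) := (Real.log_nonneg (by norm_num)).trans hlog
  -- Taking `L = 2 * log (1 / δ)` gives failure probability `4 * δ ^ 2`, which is at most `2 * δ`
  -- because `δ < 1 / 2`.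
  have hexp : 4 * Real.exp (-(2 * Real.log (1 / δ))) ≤ 2 * δ := by
    have h1 : Real.exp (-(2 * Real.log (1 / δ))) = δ ^ 2 := by
      rw [one_div, Real.log_inv, mul_neg, neg_neg,
        show 2 * Real.log δ = ((2 : ℕ) : ℝ) * Real.log δ by norm_num, Real.exp_nat_mul,
        Real.exp_log hδ0]
    rw [h1]
    nlinarith
  obtain ⟨A, hA, hμA, hdev⟩ := HalfspaceDepth.exists_event_abs_empiricalMeasure_sub_le hn
    (HalfspaceDepth.contaminated ε P Q) (L := 2 * Real.log (1 / δ)) (by positivity) μ hX hmap hind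
  refine ⟨A, hA, by linarith, fun ω hω => ?_⟩
  have := HalfspaceDepth.isProbabilityMeasure_empiricalMeasure hn fun i => X i ω
  refine (HalfspaceDepth.abs_depth_median_sub_le (Q := Q) hε0 hε1 (hdev ω hω)).trans ?_
  have := HalfspaceDepth.three_mul_chainScale_div_le hd hn hL
  linarith
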